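/- Let $d\ge 1$ and write $|\cdot|$ for Lebesgue measure on $\mathbb{R}^d$. For an open set $\Omega\subset\mathbb{R}^d$ let $H^1_0(\Omega)$ be the closure of $C^\infty_c(\Omega)$ in $H^1(\mathbb{R}^d)$, and for a Lebesgue measurable set $\Omega$ let $\widetilde H^1_0(\Omega)=\{u\in H^1(\mathbb{R}^d): u=0 \text{ a.e. on }\mathbb{R}^d\setminus\Omega\}$. For a function $f$ put $J_f(u)=\frac12\int_{\mathbb{R}^d}|\nabla u|^2\,dx-\int_{\mathbb{R}^d}uf\,dx$, and $$E_f(\Omega)=\min_{u\in H^1_0(\Omega)}J_f(u)\ \ (\Omega\text{ open}),\qquad \widetilde E_f(\Omega)=\min_{u\in \widetilde H^1_0(\Omega)}J_f(u)\ \ (\Omega\text{ measurable}).$$ For $\Psi:\mathbb{R}^d\to\mathbb{R}^d$ of class $C^1$ put $\|\Psi\|_{1,\infty}=\sup_{x}|\Psi(x)|+\sup_{x}\|D\Psi(x)\|\in[0,\infty]$, with the operator norm on matrices. For every $m\in[0,\infty)$ there is a constant $C=C_{d,m}<\infty$, depending only on $d$ and $m$, such that the following holds. Let $\Omega\subset\mathbb{R}^d$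 be a measurable set with $|\Omega|=m$, let $p\in[2,\infty]$, $f\in L^p(\mathbb{R}^d)$, and let $\Phi\in C^\infty(\mathbb{R}^d;\mathbb{R}^d)$ satisfy $\|D\Phi-\mathrm{Id}\|_{L^\infty}\le \frac12$. Then the minima defining $\widetilde E_f(\Omega)$ and $\widetilde E_f(\Phi(\Omega))$ exist, and $$\big|\widetilde E_f(\Phi(\Omega))-\widetilde E_f(\Omega)\big|\le C_{d,|\Omega|}\,\|f\|_{L^p}^2\,\|\Phi-\mathrm{Id}\|_{1,\infty}.$$ If moreover $\Omega$ is open, then the minima defining $E_f(\Omega)$ and $E_f(\Phi(\Omega))$ exist, and $$\big|E_f(\Phi(\Omega))-E_f(\Omega)\big|\le C_{d,|\Omega|}\,\|f\|_{L^p}^2\,\|\Phi-\mathrm{Id}\|_{1,\infty}.$$ (With the convention $0\cdot\infty=0$ on the right-hand side.) -/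

import Mathlib

open MeasureTheory Filter Topology
open scoped ENNReal NNReal ContDiff

namespace DirichletEnergy

/-- `g` is the weak (distributional) gradient of `u` on `ℝ^d`. -/
def IsWeakGradient {d : ℕ} (u : EuclideanSpace ℝ (Fin d) → ℝ)
    (g : EuclideanSpace ℝ (Fin d) → EuclideanSpace ℝ (Fin d)) : Prop :=
  ∀ φ : EuclideanSpace ℝ (Fin d) → ℝ, ContDiff ℝ ∞ φ → HasCompactSupport φ →
    ∀ v : EuclideanSpace ℝ (Fin d),
      (∫ x, u x * fderiv ℝ φ x v) = -(∫ x, φ x * inner ℝ (g x) v)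

/-- `u ∈ H¹(ℝ^d)`, with weak gradient `g`. The gradient, which is determined by `u` almost
everywhere, is carried along as a second argument. -/
structure MemH1 {d : ℕ} (u : EuclideanSpace ℝ (Fin d) → ℝ)
    (g : EuclideanSpace ℝ (Fin d) → EuclideanSpace ℝ (Fin d)) : Prop where
  memLp : MemLp u 2 volume
  memLp_grad : MemLp g 2 volume
  isWeakGradient : IsWeakGradient u g

/-- `u ∈ H¹₀(Ω)` for an open set `Ω`, with weak gradient `g`: `u` belongs to the closure of
`C_c^∞(Ω)` in `H¹(ℝ^d)`. -/
structure MemH10 {d : ℕ} (Ω : Set (EuclideanSpace ℝ (Fin d)))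
    (u : EuclideanSpace ℝ (Fin d) → ℝ)
    (g : EuclideanSpace ℝ (Fin d) → EuclideanSpace ℝ (Fin d)) : Prop where
  memH1 : MemH1 u g
  mem_closure : ∃ φ : ℕ → EuclideanSpace ℝ (Fin d) → ℝ,
    (∀ n, ContDiff ℝ ∞ (φ n) ∧ HasCompactSupport (φ n) ∧ tsupport (φ n) ⊆ Ω) ∧
    Tendsto (fun n => eLpNorm (fun x => u x - φ n x) 2 volume) atTop (𝓝 0) ∧
    Tendsto (fun n => eLpNorm (fun x => g x - gradient (φ n) x) 2 volume) atTop (𝓝 0)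

/-- `u` belongs to the Sobolev-like space `H̃¹₀(Ω)` of a measurable set `Ω`, with weak
gradient `g`. -/
structure MemH10Tilde {d : ℕ} (Ω : Set (EuclideanSpace ℝ (Fin d)))
    (u : EuclideanSpace ℝ (Fin d) → ℝ)
    (g : EuclideanSpace ℝ (Fin d) → EuclideanSpace ℝ (Fin d)) : Prop where
  memH1 : MemH1 u g
  ae_eq_zero : ∀ᵐ x ∂(volume : Measure (EuclideanSpace ℝ (Fin d))), x ∉ Ω → u x = 0

/-- The functional `J_f(u) = ½ ∫ |∇u|² - ∫ u f`, where `g = ∇u`. -/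
noncomputable def J {d : ℕ} (f u : EuclideanSpace ℝ (Fin d) → ℝ)
    (g : EuclideanSpace ℝ (Fin d) → EuclideanSpace ℝ (Fin d)) : ℝ :=
  (1 / 2) * (∫ x, ‖g x‖ ^ 2) - (∫ x, u x * f x)

/-- The values that `J_f` takes on `H¹₀(Ω)`. -/
def values {d : ℕ} (f : EuclideanSpace ℝ (Fin d) → ℝ)
    (Ω : Set (EuclideanSpace ℝ (Fin d))) : Set ℝ :=
  {e | ∃ u g, MemH10 Ω u g ∧ e = J f u g}

/-- The values that `J_f` takes on `H̃¹₀(Ω)`. -/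
def valuesTilde {d : ℕ} (f : EuclideanSpace ℝ (Fin d) → ℝ)
    (Ω : Set (EuclideanSpace ℝ (Fin d))) : Set ℝ :=
  {e | ∃ u g, MemH10Tilde Ω u g ∧ e = J f u g}

/-- The Dirichlet energy `E_f(Ω)`, the minimum of `J_f` over `H¹₀(Ω)`. -/
noncomputable def energy {d : ℕ} (f : EuclideanSpace ℝ (Fin d) → ℝ)
    (Ω : Set (EuclideanSpace ℝ (Fin d))) : ℝ :=
  sInf (values f Ω)

/-- The Dirichlet energy `Ẽ_f(Ω)`, the minimum of `J_f` over `H̃¹₀(Ω)`. -/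
noncomputable def energyTilde {d : ℕ} (f : EuclideanSpace ℝ (Fin d) → ℝ)
    (Ω : Set (EuclideanSpace ℝ (Fin d))) : ℝ :=
  sInf (valuesTilde f Ω)

/-- The `C¹`-norm `‖Ψ‖_{1,∞} = sup |Ψ| + sup ‖DΨ‖` (operator norm), with values in `[0,∞]`. -/
noncomputable def c1Norm {d : ℕ}
    (Ψ : EuclideanSpace ℝ (Fin d) → EuclideanSpace ℝ (Fin d)) : ℝ≥0∞ :=
  (⨆ x, ‖Ψ x‖ₑ) + ⨆ x, ‖fderiv ℝ Ψ x‖ₑ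

end DirichletEnergy

namespace DirichletEnergy

/-! Competitors are transported by the deformation. If `u` minimizes on `Ω`, then `u ∘ Φ⁻¹` is
admissible on `Φ(Ω)`; exchanging `Φ` and `Φ⁻¹` gives the reverse inequality, so the one-sided
estimate `J_comp_le` suffices. Let `δ = sup ‖DΦ - Id‖ ≤ 1/2` and `ε = sup |Φ - id|`. Both maps are
bi-Lipschitz with constant `1 + 2δ`, so the Dirichlet integral grows at most by the factor `(1 +
2δ)^(d+2) = 1 + O(δ)`. The linear term changes by `∫ (u ∘ T - u) f`. Integrating `∇u` along segments
gives `‖u ∘ T - u‖₂ ≤ C ε ‖∇u‖₂`, and Hölder on the union of the two supports, which has finite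
measure, admits every `p ≥ 2` with one constant.

The bound `‖∇u‖₂ ≤ C ‖f‖_p` follows from `J(u) ≤ J(0) = 0` and the Poincaré inequality
`MemH1.poincare` on sets of finite measure. There `‖u(· - y) - u‖₂ ≤ |y| ‖∇u‖₂`, while on average
over `y` in a ball of volume at least `2|A|` the overlap of `|u(· - y)|` with `|u|` is at most half
of `‖u‖₂²`. The same inequality makes the Dirichlet form coercive, and Lax–Milgram then gives the
minimizers.

Both function spaces enter only as closed subspaces of `H¹`, carried by composition with
bi-Lipschitz smooth maps to the space of the preimage set, and contained in `H̃¹₀`. Hence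
`stability` treats them together. -/

/-- Euclidean space of dimension `d`. -/
abbrev Space (d : ℕ) : Type := EuclideanSpace ℝ (Fin d)

variable {d : ℕ}

/-! ### Volume and `L²` norms under antilipschitz maps -/

section Distortion

theorem eLpNorm_two_sq {α F : Type*} {m : MeasurableSpace α} [ENorm F]
    (w : α → F) (μ : Measure α) :
    eLpNorm w 2 μ ^ 2 = ∫⁻ x, ‖w x‖ₑ ^ 2 ∂μ := by
  have := eLpNorm_nnreal_pow_eq_lintegral (f := w) (μ := μ) (p := 2) two_ne_zero
  simpa using this

theorem integral_norm_sq_eq {α F : Type*} {m : MeasurableSpace α} [NormedAddCommGroup F]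
    {w : α → F} {μ : Measure α} (hw : MemLp w 2 μ) :
    ∫ x, ‖w x‖ ^ 2 ∂μ = (eLpNorm w 2 μ).toReal ^ 2 := by
  rw [← ENNReal.toReal_pow, eLpNorm_two_sq, integral_eq_lintegral_of_nonneg_ae
    (.of_forall fun _ => by positivity)
    (show AEStronglyMeasurable (fun x => ‖w x‖ ^ 2) μ from hw.1.norm.pow 2)]
  congr 1
  refine lintegral_congr fun x => ?_
  rw [ENNReal.ofReal_pow (norm_nonneg _), ofReal_norm]

theorem sq_lintegral_le {α : Type*} {m : MeasurableSpace α} {ν : Measure α}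
    [IsProbabilityMeasure ν] {h : α → ℝ≥0∞} (hh : AEMeasurable h ν) :
    (∫⁻ x, h x ∂ν) ^ 2 ≤ ∫⁻ x, h x ^ 2 ∂ν := by
  have h1 := eLpNorm_le_eLpNorm_of_exponent_le (p := 1) (q := 2) (by norm_num)
    hh.aestronglyMeasurable
  have h2 := pow_le_pow_left' h1 2
  rw [eLpNorm_two_sq, eLpNorm_one_eq_lintegral_enorm] at h2
  simpa using h2

/-- Preimages under antilipschitz maps have controlled volume. -/
theorem volume_preimage_le {K : ℝ≥0} {T : Space d → Space d} (hT : AntilipschitzWith K T)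
    (s : Set (Space d)) : volume (T ⁻¹' s) ≤ (K : ℝ≥0∞) ^ d * volume s := by
  -- Lebesgue measure is a multiple of `d`-dimensional Hausdorff measure, whose distortion is
  -- governed by the metric alone; no Jacobian is needed.
  rw [← EuclideanSpace.euclideanHausdorffMeasure_eq_volume,
    Measure.euclideanHausdorffMeasure_def]
  simp only [Measure.smul_apply, ENNReal.smul_def, smul_eq_mul]
  have h := hT.hausdorffMeasure_preimage_le (Nat.cast_nonneg d) s
  rw [ENNReal.rpow_natCast] at h
  calc _ ≤ _ := mul_le_mul_right h _
    _ = _ := by ring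

theorem map_volume_le {K : ℝ≥0} {T : Space d → Space d} (hT : AntilipschitzWith K T)
    (hm : Measurable T) :
    (volume : Measure (Space d)).map T ≤ ((K : ℝ≥0∞) ^ d) • volume := by
  refine Measure.le_iff.2 fun s hs => ?_
  rw [Measure.map_apply hm hs]
  simpa using volume_preimage_le hT s

theorem quasiMeasurePreserving_of_antilipschitz {K : ℝ≥0} {T : Space d → Space d}
    (hT : AntilipschitzWith K T) (hm : Measurable T) :
    Measure.QuasiMeasurePreserving T volume volume :=
  ⟨hm, (map_volume_le hT hm).absolutelyContinuous.trans
    Measure.smul_absolutelyContinuous⟩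

theorem lintegral_comp_le {K : ℝ≥0} {T : Space d → Space d} (hT : AntilipschitzWith K T)
    (hm : Measurable T) {h : Space d → ℝ≥0∞} (hh : AEMeasurable h volume) :
    ∫⁻ x, h (T x) ≤ (K : ℝ≥0∞) ^ d * ∫⁻ x, h x := by
  have hq := quasiMeasurePreserving_of_antilipschitz hT hm
  rw [← lintegral_map' (hh.mono_ac hq.absolutelyContinuous) hm.aemeasurable]
  calc _ ≤ ∫⁻ x, h x ∂(((K : ℝ≥0∞) ^ d) • volume) :=
        lintegral_mono' (map_volume_le hT hm) le_rfl
    _ = _ := by simp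

theorem eLpNorm_comp_sq_le {F : Type*} [NormedAddCommGroup F] {K : ℝ≥0}
    {T : Space d → Space d} (hT : AntilipschitzWith K T) (hm : Measurable T)
    {w : Space d → F} (hw : AEStronglyMeasurable w volume) :
    eLpNorm (fun x => w (T x)) 2 volume ^ 2 ≤ (K : ℝ≥0∞) ^ d * eLpNorm w 2 volume ^ 2 := by
  rw [eLpNorm_two_sq, eLpNorm_two_sq]
  exact lintegral_comp_le hT hm (hw.enorm.pow_const 2)

/-- The squared estimate gives `K^(d/2)`; for `1 ≤ K` the cruder `K^d` avoids roots. -/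
theorem eLpNorm_comp_le {F : Type*} [NormedAddCommGroup F] {K : ℝ≥0} (hK : 1 ≤ K)
    {T : Space d → Space d} (hT : AntilipschitzWith K T) (hm : Measurable T)
    {w : Space d → F} (hw : AEStronglyMeasurable w volume) :
    eLpNorm (fun x => w (T x)) 2 volume ≤ (K : ℝ≥0∞) ^ d * eLpNorm w 2 volume := by
  rw [← ENNReal.pow_le_pow_left_iff two_ne_zero, mul_pow]
  refine (eLpNorm_comp_sq_le hT hm hw).trans (mul_le_mul_left ?_ _)
  exact le_self_pow (one_le_pow_of_one_le' (by exact_mod_cast hK) d) two_ne_zero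

theorem memLp_comp {F : Type*} [NormedAddCommGroup F] {K : ℝ≥0}
    {T : Space d → Space d} (hT : AntilipschitzWith K T) (hm : Measurable T)
    {w : Space d → F} (hw : MemLp w 2 volume) : MemLp (fun x => w (T x)) 2 volume := by
  refine ⟨hw.1.comp_quasiMeasurePreserving (quasiMeasurePreserving_of_antilipschitz hT hm), ?_⟩
  have h := eLpNorm_comp_sq_le hT hm hw.1
  have h2 : (K : ℝ≥0∞) ^ d * eLpNorm w 2 volume ^ 2 < ⊤ :=
    ENNReal.mul_lt_top (ENNReal.pow_lt_top ENNReal.coe_lt_top) (ENNReal.pow_lt_top hw.2)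
  exact ((ENNReal.pow_lt_top_iff).1 (h.trans_lt h2)).resolve_right (by norm_num)

end Distortion

/-! ### Strong and weak convergence in `L²` -/

section Limits

variable {α F : Type*} {mα : MeasurableSpace α} {μ : Measure α}

theorem integral_mul_eq_inner {v ψ : α → ℝ} (hv : MemLp v 2 μ) (hψ : MemLp ψ 2 μ) :
    ∫ x, v x * ψ x ∂μ = inner ℝ (hψ.toLp ψ) (hv.toLp v) := by
  rw [L2.inner_def]
  refine integral_congr_ae ?_
  filter_upwards [hψ.coeFn_toLp, hv.coeFn_toLp] with x h1 h2
  simp [h1, h2]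

theorem abs_integral_mul_le {v ψ : α → ℝ} (hv : MemLp v 2 μ) (hψ : MemLp ψ 2 μ) :
    |∫ x, v x * ψ x ∂μ| ≤ (eLpNorm v 2 μ).toReal * (eLpNorm ψ 2 μ).toReal := by
  rw [integral_mul_eq_inner hv hψ, ← Lp.norm_toLp v hv, ← Lp.norm_toLp ψ hψ, mul_comm]
  exact abs_real_inner_le_norm _ _

theorem tendsto_toLp [NormedAddCommGroup F] {u : α → F} {U : ℕ → α → F}
    (hu : MemLp u 2 μ) (hU : ∀ n, MemLp (U n) 2 μ)
    (h : Tendsto (fun n => eLpNorm (fun x => u x - U n x) 2 μ) atTop (𝓝 0)) :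
    Tendsto (fun n => (hU n).toLp (U n)) atTop (𝓝 (hu.toLp u)) := by
  rw [Lp.tendsto_Lp_iff_tendsto_eLpNorm']
  refine h.congr fun n => ?_
  rw [← eLpNorm_neg]
  refine eLpNorm_congr_ae ?_
  filter_upwards [(hU n).coeFn_toLp, hu.coeFn_toLp] with x h1 h2
  simp [h1, h2]

/-- `L²` convergence implies weak convergence. -/
theorem tendsto_integral_mul_of_tendsto_eLpNorm {u : α → ℝ} {U : ℕ → α → ℝ} {ψ : α → ℝ}
    (hu : MemLp u 2 μ) (hU : ∀ n, MemLp (U n) 2 μ) (hψ : MemLp ψ 2 μ)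
    (h : Tendsto (fun n => eLpNorm (fun x => u x - U n x) 2 μ) atTop (𝓝 0)) :
    Tendsto (fun n => ∫ x, U n x * ψ x ∂μ) atTop (𝓝 (∫ x, u x * ψ x ∂μ)) := by
  rw [integral_mul_eq_inner hu hψ]
  simp_rw [fun n => integral_mul_eq_inner (hU n) hψ]
  exact Tendsto.inner tendsto_const_nhds (tendsto_toLp hu hU h)

end Limits

/-! ### Weak gradients and the linear structure of `H¹` -/

section WeakGradient

theorem inner_gradient_eq {u : Space d → ℝ} (x v : Space d) :
    inner ℝ (gradient u x) v = fderiv ℝ u x v := by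
  simp [gradient]

theorem norm_gradient_eq {u : Space d → ℝ} (x : Space d) :
    ‖gradient u x‖ = ‖fderiv ℝ u x‖ := by
  simp [gradient]

theorem enorm_gradient_eq {u : Space d → ℝ} (x : Space d) :
    ‖gradient u x‖ₑ = ‖fderiv ℝ u x‖ₑ := by
  rw [← ofReal_norm, ← ofReal_norm, norm_gradient_eq]

theorem continuous_gradient {u : Space d → ℝ} (hu : ContDiff ℝ ∞ u) :
    Continuous (gradient u) := by
  have := hu.continuous_fderiv (by simp)
  unfold gradient
  fun_prop

theorem hasCompactSupport_gradient {u : Space d → ℝ} (hu : HasCompactSupport u) :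
    HasCompactSupport (gradient u) := by
  have := hu.fderiv (𝕜 := ℝ)
  exact this.comp_left (g := fun L => (InnerProductSpace.toDual ℝ (Space d)).symm L) (by simp)

theorem isWeakGradient_gradient {u : Space d → ℝ} (hu : ContDiff ℝ ∞ u) :
    IsWeakGradient u (gradient u) := by
  intro φ hφ hc v
  have hu0 := hu.continuous
  have hφ0 := hφ.continuous
  have hu1 : Continuous fun x => fderiv ℝ u x v :=
    (hu.continuous_fderiv (by simp)).clm_apply continuous_const
  have hφ1 : Continuous fun x => fderiv ℝ φ x v :=
    (hφ.continuous_fderiv (by simp)).clm_apply continuous_const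
  have hc1 : HasCompactSupport fun x => fderiv ℝ φ x v := hc.fderiv_apply (𝕜 := ℝ) v
  rw [integral_mul_fderiv_eq_neg_fderiv_mul_of_integrable]
  · simp only [inner_gradient_eq, mul_comm]
  · exact (hu1.mul hφ0).integrable_of_hasCompactSupport hc.mul_left
  · exact (hu0.mul hφ1).integrable_of_hasCompactSupport hc1.mul_left
  · exact (hu0.mul hφ0).integrable_of_hasCompactSupport hc.mul_left
  · exact fun x _ => (hu.differentiable (by simp)) x
  · exact fun x _ => (hφ.differentiable (by simp)) x

/-- Weak gradients are stable under `L²` limits. -/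
theorem isWeakGradient_of_tendsto {u : Space d → ℝ} {g : Space d → Space d}
    {U : ℕ → Space d → ℝ} {G : ℕ → Space d → Space d}
    (hu : MemLp u 2 volume) (hg : MemLp g 2 volume)
    (hU : ∀ n, MemLp (U n) 2 volume) (hG : ∀ n, MemLp (G n) 2 volume)
    (hUG : ∀ n, IsWeakGradient (U n) (G n))
    (hlu : Tendsto (fun n => eLpNorm (fun x => u x - U n x) 2 volume) atTop (𝓝 0))
    (hlg : Tendsto (fun n => eLpNorm (fun x => g x - G n x) 2 volume) atTop (𝓝 0)) :
    IsWeakGradient u g := by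
  intro φ hφ hc v
  have hφ1 : Continuous fun x => fderiv ℝ φ x v :=
    (hφ.continuous_fderiv (by simp)).clm_apply continuous_const
  have hc1 : HasCompactSupport fun x => fderiv ℝ φ x v := hc.fderiv_apply (𝕜 := ℝ) v
  have h1 := tendsto_integral_mul_of_tendsto_eLpNorm hu hU
    (hφ1.memLp_of_hasCompactSupport hc1) hlu
  have hlv : Tendsto (fun n => eLpNorm (fun x => inner ℝ (g x) v - inner ℝ (G n x) v) 2
      (volume : Measure (Space d))) atTop (𝓝 0) := by
    have hb : Tendsto (fun n => ENNReal.ofReal ‖v‖ *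
        eLpNorm (fun x => g x - G n x) 2 volume) atTop (𝓝 0) := by
      simpa using ENNReal.Tendsto.const_mul hlg (Or.inr ENNReal.ofReal_ne_top)
        (a := ENNReal.ofReal ‖v‖)
    refine tendsto_of_tendsto_of_tendsto_of_le_of_le tendsto_const_nhds hb
      (fun _ => zero_le) fun n => ?_
    refine eLpNorm_le_mul_eLpNorm_of_ae_le_mul (.of_forall fun x => ?_) 2
    rw [← inner_sub_left, mul_comm]
    exact norm_inner_le_norm _ _
  have h2 := tendsto_integral_mul_of_tendsto_eLpNorm (ψ := φ) (hg.inner_const v)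
    (fun n => (hG n).inner_const v) (hφ.continuous.memLp_of_hasCompactSupport hc) hlv
  have h3 := h2.neg
  simp only [mul_comm _ (φ _)] at h3
  refine tendsto_nhds_unique h1 (h3.congr fun n => ?_)
  exact (hUG n φ hφ hc v).symm

theorem memH1_of_contDiff_hasCompactSupport {φ : Space d → ℝ} (hφ : ContDiff ℝ ∞ φ)
    (hc : HasCompactSupport φ) : MemH1 φ (gradient φ) where
  memLp := hφ.continuous.memLp_of_hasCompactSupport hc
  memLp_grad := (continuous_gradient hφ).memLp_of_hasCompactSupport
    (hasCompactSupport_gradient hc)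
  isWeakGradient := isWeakGradient_gradient hφ

theorem MemH1.congr {u u' : Space d → ℝ} {g g' : Space d → Space d} (h : MemH1 u g)
    (hu : u =ᵐ[volume] u') (hg : g =ᵐ[volume] g') : MemH1 u' g' where
  memLp := h.memLp.ae_eq hu
  memLp_grad := h.memLp_grad.ae_eq hg
  isWeakGradient φ hφ hc v := by
    have h1 : ∫ x, u x * fderiv ℝ φ x v = ∫ x, u' x * fderiv ℝ φ x v :=
      integral_congr_ae (by filter_upwards [hu] with x hx; simp [hx])
    have h2 : ∫ x, φ x * inner ℝ (g x) v = ∫ x, φ x * inner ℝ (g' x) v :=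
      integral_congr_ae (by filter_upwards [hg] with x hx; simp [hx])
    rw [← h1, ← h2]
    exact h.isWeakGradient φ hφ hc v

theorem memH1_of_tendsto {u : Space d → ℝ} {g : Space d → Space d}
    {U : ℕ → Space d → ℝ} {G : ℕ → Space d → Space d}
    (hu : MemLp u 2 volume) (hg : MemLp g 2 volume) (hUG : ∀ n, MemH1 (U n) (G n))
    (hlu : Tendsto (fun n => eLpNorm (fun x => u x - U n x) 2 volume) atTop (𝓝 0))
    (hlg : Tendsto (fun n => eLpNorm (fun x => g x - G n x) 2 volume) atTop (𝓝 0)) :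
    MemH1 u g :=
  ⟨hu, hg, isWeakGradient_of_tendsto hu hg (fun n => (hUG n).memLp)
    (fun n => (hUG n).memLp_grad) (fun n => (hUG n).isWeakGradient) hlu hlg⟩

theorem MemH1.zero : MemH1 (fun _ : Space d => (0 : ℝ)) (fun _ => 0) where
  memLp := MemLp.zero'
  memLp_grad := MemLp.zero'
  isWeakGradient φ _ _ v := by simp

theorem MemH1.add {u u' : Space d → ℝ} {g g' : Space d → Space d} (h : MemH1 u g)
    (h' : MemH1 u' g') : MemH1 (fun x => u x + u' x) (fun x => g x + g' x) where
  memLp := h.memLp.add h'.memLp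
  memLp_grad := h.memLp_grad.add h'.memLp_grad
  isWeakGradient φ hφ hc v := by
    have hφ1 : Continuous fun x => fderiv ℝ φ x v :=
      (hφ.continuous_fderiv (by simp)).clm_apply continuous_const
    have hc1 : HasCompactSupport fun x => fderiv ℝ φ x v := hc.fderiv_apply (𝕜 := ℝ) v
    have m1 : MemLp (fun x => fderiv ℝ φ x v) 2 volume := hφ1.memLp_of_hasCompactSupport hc1
    have m2 : MemLp φ 2 volume := hφ.continuous.memLp_of_hasCompactSupport hc
    simp only [add_mul, inner_add_left, mul_add]
    have i1 : Integrable (fun x => u x * fderiv ℝ φ x v) volume := h.memLp.integrable_mul m1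
    have i2 : Integrable (fun x => u' x * fderiv ℝ φ x v) volume := h'.memLp.integrable_mul m1
    have i3 : Integrable (fun x => φ x * inner ℝ (g x) v) volume :=
      m2.integrable_mul (h.memLp_grad.inner_const v)
    have i4 : Integrable (fun x => φ x * inner ℝ (g' x) v) volume :=
      m2.integrable_mul (h'.memLp_grad.inner_const v)
    rw [integral_add i1 i2, integral_add i3 i4,
      h.isWeakGradient φ hφ hc v, h'.isWeakGradient φ hφ hc v]
    ring

theorem MemH1.smul {u : Space d → ℝ} {g : Space d → Space d} (h : MemH1 u g) (c : ℝ) :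
    MemH1 (fun x => c * u x) (fun x => c • g x) where
  memLp := h.memLp.const_mul c
  memLp_grad := h.memLp_grad.const_smul c
  isWeakGradient φ hφ hc v := by
    have := h.isWeakGradient φ hφ hc v
    simp only [inner_smul_left, mul_assoc, mul_left_comm (φ _), integral_const_mul, this]
    simp

end WeakGradient

/-! ### Density of smooth functions in `H¹` -/

section Mollification

open scoped Convolution

variable {F : Type*} [NormedAddCommGroup F]

/-- Continuity of translations in `L²`. -/
theorem tendsto_eLpNorm_translate {w : Space d → F} (hw : MemLp w 2 volume) :
    Tendsto (fun t : Space d => eLpNorm (fun x => w (x - t) - w x) 2 volume) (𝓝 0) (𝓝 0) := by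
  let G : C(Space d, C(Space d, Space d)) :=
    (ContinuousMap.mk (fun a : Space d × Space d => a.2 - a.1) (by fun_prop)).curry
  have hG : ∀ t, MeasurePreserving (G t) volume volume := fun t =>
    measurePreserving_sub_right volume t
  have h := Filter.Tendsto.compMeasurePreservingLp
    (tendsto_const_nhds (x := hw.toLp w) (f := 𝓝 (0 : Space d)))
    (G.continuous.tendsto 0) hG (hG 0) (by norm_num)
  rw [Lp.tendsto_Lp_iff_tendsto_eLpNorm'] at h
  refine h.congr fun t => eLpNorm_congr_ae ?_
  simp_rw [Lp.toLp_compMeasurePreserving]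
  filter_upwards [(hw.comp_measurePreserving (hG t)).coeFn_toLp,
    (hw.comp_measurePreserving (hG 0)).coeFn_toLp] with x h1 h2
  simp [h1, h2, G]

variable [NormedSpace ℝ F]

/-- `ρ ⋆ w - w` is the mean of `w(· - t) - w` under the probability measure `ρ dt`. Jensen and
Tonelli bound its `L²` norm by the worst translation in the support of `ρ`. -/
theorem eLpNorm_convolution_sub_le [CompleteSpace F] {ρ : Space d → ℝ} (hρ : Continuous ρ)
    (hc : HasCompactSupport ρ) (h0 : ∀ x, 0 ≤ ρ x) (h1 : ∫ x, ρ x = 1)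
    {w : Space d → F} (hw : MemLp w 2 volume) {η : ℝ≥0∞}
    (hη : ∀ t, ρ t ≠ 0 → eLpNorm (fun x => w (x - t) - w x) 2 volume ≤ η) :
    eLpNorm (fun x => (ρ ⋆[ContinuousLinearMap.lsmul ℝ ℝ, volume] w) x - w x) 2 volume ≤ η := by
  have hmρ : Measurable fun t => ENNReal.ofReal (ρ t) := hρ.measurable.ennreal_ofReal
  have hρint : Integrable ρ volume := hρ.integrable_of_hasCompactSupport hc
  have hmass : ∫⁻ t, ENNReal.ofReal (ρ t) = 1 := by
    rw [← ofReal_integral_eq_lintegral_ofReal hρint (.of_forall h0), h1, ENNReal.ofReal_one]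
  let ν : Measure (Space d) := volume.withDensity fun t => ENNReal.ofReal (ρ t)
  have : IsProbabilityMeasure ν := ⟨by simp [ν, hmass]⟩
  have hwx : ∀ x, AEStronglyMeasurable (fun t => w (x - t) - w x) volume := fun x =>
    (hw.1.comp_quasiMeasurePreserving
      (quasiMeasurePreserving_sub_left_of_right_invariant volume x)).sub
      aestronglyMeasurable_const
  have hpt : ∀ x, ‖(ρ ⋆[ContinuousLinearMap.lsmul ℝ ℝ, volume] w) x - w x‖ₑ ^ 2 ≤
      ∫⁻ t, ENNReal.ofReal (ρ t) * ‖w (x - t) - w x‖ₑ ^ 2 := by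
    intro x
    have hint : Integrable (fun t => ρ t • w (x - t)) volume :=
      hc.convolutionExists_left (ContinuousLinearMap.lsmul ℝ ℝ) hρ
        (hw.locallyIntegrable (by norm_num)) x
    have e : (ρ ⋆[ContinuousLinearMap.lsmul ℝ ℝ, volume] w) x - w x =
        ∫ t, ρ t • (w (x - t) - w x) := by
      simp only [smul_sub]
      rw [integral_sub hint (hρint.smul_const _), integral_smul_const, h1, one_smul]
      rfl
    have e2 : ‖(ρ ⋆[ContinuousLinearMap.lsmul ℝ ℝ, volume] w) x - w x‖ₑ ≤
        ∫⁻ t, ‖w (x - t) - w x‖ₑ ∂ν := by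
      rw [e, lintegral_withDensity_eq_lintegral_mul₀ hmρ.aemeasurable (hwx x).enorm]
      refine (enorm_integral_le_lintegral_enorm _).trans (lintegral_mono fun t => ?_)
      rw [enorm_smul, Real.enorm_of_nonneg (h0 t)]
      rfl
    refine (pow_le_pow_left' e2 2).trans ?_
    refine (sq_lintegral_le ((hwx x).enorm.mono_ac
      (withDensity_absolutelyContinuous _ _))).trans_eq ?_
    rw [lintegral_withDensity_eq_lintegral_mul₀ hmρ.aemeasurable ((hwx x).enorm.pow_const 2)]
    rfl
  have hmeas : AEMeasurable (Function.uncurry fun x t : Space d =>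
      ENNReal.ofReal (ρ t) * ‖w (x - t) - w x‖ₑ ^ 2) (volume.prod volume) := by
    refine AEMeasurable.mul (hmρ.comp measurable_snd).aemeasurable (AEMeasurable.pow_const ?_ 2)
    refine AEStronglyMeasurable.enorm (AEStronglyMeasurable.sub ?_ ?_)
    · exact hw.1.comp_quasiMeasurePreserving
        (quasiMeasurePreserving_sub_of_right_invariant volume volume)
    · exact hw.1.comp_quasiMeasurePreserving Measure.quasiMeasurePreserving_fst
  rw [← ENNReal.pow_le_pow_left_iff two_ne_zero, eLpNorm_two_sq]
  calc ∫⁻ x, ‖(ρ ⋆[ContinuousLinearMap.lsmul ℝ ℝ, volume] w) x - w x‖ₑ ^ 2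
      ≤ ∫⁻ x, ∫⁻ t, ENNReal.ofReal (ρ t) * ‖w (x - t) - w x‖ₑ ^ 2 := lintegral_mono hpt
    _ = ∫⁻ t, ∫⁻ x, ENNReal.ofReal (ρ t) * ‖w (x - t) - w x‖ₑ ^ 2 :=
        lintegral_lintegral_swap hmeas
    _ ≤ ∫⁻ t, ENNReal.ofReal (ρ t) * η ^ 2 := by
        refine lintegral_mono fun t => ?_
        rw [lintegral_const_mul' _ _ ENNReal.ofReal_ne_top]
        by_cases ht : ρ t = 0
        · simp [ht]
        · have := pow_le_pow_left' (hη t ht) 2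
          rw [eLpNorm_two_sq] at this
          exact mul_le_mul_right this _
    _ = η ^ 2 := by rw [lintegral_mul_const _ hmρ, hmass, one_mul]

/-- Writing `ρ ⋆ w = (ρ ⋆ w - w) + w` replaces Young's inequality. -/
theorem memLp_convolution_of_sub {ρ : Space d → ℝ} {w : Space d → F} (hw : MemLp w 2 volume)
    (hρ : Continuous ρ) (hc : HasCompactSupport ρ) {η : ℝ≥0∞} (hη : η ≠ ⊤)
    (h : eLpNorm (fun x => (ρ ⋆[ContinuousLinearMap.lsmul ℝ ℝ, volume] w) x - w x) 2 volume ≤ η) :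
    MemLp (ρ ⋆[ContinuousLinearMap.lsmul ℝ ℝ, volume] w) 2 volume := by
  have hcont : Continuous (ρ ⋆[ContinuousLinearMap.lsmul ℝ ℝ, volume] w) :=
    hc.continuous_convolution_left _ hρ (hw.locallyIntegrable (by norm_num))
  have h2 : MemLp (fun x => (ρ ⋆[ContinuousLinearMap.lsmul ℝ ℝ, volume] w) x - w x) 2 volume :=
    ⟨hcont.aestronglyMeasurable.sub hw.1, h.trans_lt hη.lt_top⟩
  have h3 := h2.add hw
  refine h3.ae_eq (.of_forall fun x => ?_)
  simp

/-- The derivative falls on `ρ`; testing the weak gradient against `t ↦ ρ (x - t)` moves it to `u`,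
the sign from the reflection cancelling that of integration by parts. -/
theorem gradient_convolution {ρ : Space d → ℝ} (hρ : ContDiff ℝ ∞ ρ)
    (hc : HasCompactSupport ρ) {u : Space d → ℝ} {g : Space d → Space d} (h : MemH1 u g) :
    gradient (ρ ⋆[ContinuousLinearMap.lsmul ℝ ℝ, volume] u) =
      ρ ⋆[ContinuousLinearMap.lsmul ℝ ℝ, volume] g := by
  ext1 x
  have hu := h.memLp.locallyIntegrable (by norm_num)
  have hg := h.memLp_grad.locallyIntegrable (by norm_num)
  refine ext_inner_right ℝ fun v => ?_
  rw [inner_gradient_eq, (hc.hasFDerivAt_convolution_left (ContinuousLinearMap.lsmul ℝ ℝ)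
    (hρ.of_le (by simp)) hu x).fderiv]
  have hint : Integrable (fun t => ρ t • g (x - t)) volume :=
    hc.convolutionExists_left (ContinuousLinearMap.lsmul ℝ ℝ) hρ.continuous hg x
  have hint2 := (hc.fderiv (𝕜 := ℝ)).convolutionExists_left
    ((ContinuousLinearMap.lsmul ℝ ℝ).precompL (Space d) : _ →L[ℝ] ℝ →L[ℝ] _)
    (hρ.continuous_fderiv (by simp)) hu x
  have e1 : inner ℝ ((ρ ⋆[ContinuousLinearMap.lsmul ℝ ℝ, volume] g) x) v =
      ∫ t, ρ (x - t) * inner ℝ (g t) v := by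
    rw [convolution_def, real_inner_comm]
    simp only [ContinuousLinearMap.lsmul_apply]
    rw [← integral_inner hint, ← integral_sub_left_eq_self _ volume x]
    simp [inner_smul_right, real_inner_comm]
  have e2 : ((fderiv ℝ ρ) ⋆[(ContinuousLinearMap.lsmul ℝ ℝ).precompL (Space d), volume] u) x v =
      ∫ t, u t * fderiv ℝ ρ (x - t) v := by
    rw [convolution_def, ContinuousLinearMap.integral_apply hint2,
      ← integral_sub_left_eq_self _ volume x]
    simp [ContinuousLinearMap.precompL_apply, mul_comm]
  rw [e1, e2]
  have hφ : ContDiff ℝ ∞ fun t => ρ (x - t) := by fun_prop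
  have hφc : HasCompactSupport fun t => ρ (x - t) :=
    hc.comp_homeomorph (Homeomorph.subLeft x)
  have h2 := h.isWeakGradient _ hφ hφc v
  have h3 : ∀ t, fderiv ℝ (fun t => ρ (x - t)) t v = - fderiv ℝ ρ (x - t) v := by
    intro t
    have hx : HasFDerivAt (fun t => x - t) (-ContinuousLinearMap.id ℝ (Space d)) t :=
      (hasFDerivAt_id t).const_sub x
    have hd := ((hρ.differentiable (by simp)) (x - t)).hasFDerivAt.comp t hx
    have hd' : fderiv ℝ (fun t => ρ (x - t)) t = _ := hd.fderiv
    rw [hd']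
    simp
  simp only [h3, mul_neg, integral_neg, neg_inj] at h2
  exact h2

/-- Smooth functions are dense in `H¹`. -/
theorem MemH1.exists_smooth_approx {u : Space d → ℝ} {g : Space d → Space d} (h : MemH1 u g) :
    ∃ φ : ℕ → Space d → ℝ, (∀ n, ContDiff ℝ ∞ (φ n) ∧ MemH1 (φ n) (gradient (φ n))) ∧
      Tendsto (fun n => eLpNorm (fun x => u x - φ n x) 2 volume) atTop (𝓝 0) ∧
      Tendsto (fun n => eLpNorm (fun x => g x - gradient (φ n) x) 2 volume) atTop (𝓝 0) := by
  have key : ∀ η : ℝ≥0∞, η ≠ ⊤ → 0 < η → ∃ φ : Space d → ℝ,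
      (ContDiff ℝ ∞ φ ∧ MemH1 φ (gradient φ)) ∧
      eLpNorm (fun x => u x - φ x) 2 volume ≤ η ∧
      eLpNorm (fun x => g x - gradient φ x) 2 volume ≤ η := by
    intro η hη h0
    obtain ⟨r, hr, hball⟩ := Metric.eventually_nhds_iff_ball.1
      (((tendsto_eLpNorm_translate h.memLp).eventually (Iic_mem_nhds h0)).and
        ((tendsto_eLpNorm_translate h.memLp_grad).eventually (Iic_mem_nhds h0)))
    let b : ContDiffBump (0 : Space d) := ⟨r / 2, r, by positivity, by linarith⟩
    let ρ := b.normed volume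
    have hρ : ContDiff ℝ ∞ ρ := b.contDiff_normed
    have hρc : HasCompactSupport ρ := b.hasCompactSupport_normed
    have hs : ∀ t, ρ t ≠ 0 → t ∈ Metric.ball (0 : Space d) r := fun t ht => by
      have : t ∈ Function.support ρ := ht
      rwa [b.support_normed_eq] at this
    have h1 := eLpNorm_convolution_sub_le hρ.continuous hρc b.nonneg_normed b.integral_normed
      h.memLp (fun t ht => (hball t (hs t ht)).1)
    have h2 := eLpNorm_convolution_sub_le hρ.continuous hρc b.nonneg_normed b.integral_normed
      h.memLp_grad (fun t ht => (hball t (hs t ht)).2)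
    have hsm : ContDiff ℝ ∞ (ρ ⋆[ContinuousLinearMap.lsmul ℝ ℝ, volume] u) :=
      hρc.contDiff_convolution_left _ hρ (h.memLp.locallyIntegrable (by norm_num))
    have hgr := gradient_convolution hρ hρc h
    refine ⟨ρ ⋆[ContinuousLinearMap.lsmul ℝ ℝ, volume] u, ⟨hsm, ?_, ?_,
      isWeakGradient_gradient hsm⟩, ?_, ?_⟩
    · exact memLp_convolution_of_sub h.memLp hρ.continuous hρc hη h1
    · rw [hgr]
      exact memLp_convolution_of_sub h.memLp_grad hρ.continuous hρc hη h2
    · exact (eLpNorm_sub_comm u _ 2 volume).trans_le h1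
    · rw [hgr]
      exact (eLpNorm_sub_comm g _ 2 volume).trans_le h2
  choose φ hφ using fun n : ℕ => key ((n : ℝ≥0∞) + 1)⁻¹ (by simp) (by simp)
  have hlim : Tendsto (fun n : ℕ => ((n : ℝ≥0∞) + 1)⁻¹) atTop (𝓝 0) := by
    have := (tendsto_add_atTop_iff_nat 1).2 ENNReal.tendsto_inv_nat_nhds_zero
    simpa using this
  exact ⟨φ, fun n => (hφ n).1,
    tendsto_of_tendsto_of_tendsto_of_le_of_le tendsto_const_nhds hlim (fun _ => zero_le)
      fun n => (hφ n).2.1,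
    tendsto_of_tendsto_of_tendsto_of_le_of_le tendsto_const_nhds hlim (fun _ => zero_le)
      fun n => (hφ n).2.2⟩

end Mollification

/-! ### Composition of `H¹` functions with bi-Lipschitz smooth maps -/

section Pullback

/-- The gradient of `u ∘ T` in terms of the gradient `g` of `u`. -/
noncomputable def pullGrad (T : Space d → Space d) (g : Space d → Space d) :
    Space d → Space d :=
  fun x => (fderiv ℝ T x).adjoint (g (T x))

theorem gradient_comp {T : Space d → Space d} (hT : ContDiff ℝ ∞ T) {φ : Space d → ℝ}
    (hφ : ContDiff ℝ ∞ φ) : gradient (fun x => φ (T x)) = pullGrad T (gradient φ) := by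
  ext1 x
  refine ext_inner_right ℝ fun v => ?_
  have h := ((hφ.differentiable (by simp)) (T x)).hasFDerivAt.comp x
    ((hT.differentiable (by simp)) x).hasFDerivAt
  have h' : fderiv ℝ (fun x => φ (T x)) x = _ := h.fderiv
  rw [inner_gradient_eq, h', pullGrad, ContinuousLinearMap.adjoint_inner_left, inner_gradient_eq]
  rfl

variable {L : ℝ≥0} {T : Space d → Space d}

theorem enorm_pullGrad_le (hL : LipschitzWith L T) (g : Space d → Space d) (x : Space d) :
    ‖pullGrad T g x‖ₑ ≤ L * ‖g (T x)‖ₑ := by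
  have h : ‖pullGrad T g x‖ ≤ L * ‖g (T x)‖ := by
    refine (ContinuousLinearMap.le_opNorm _ _).trans ?_
    rw [LinearIsometryEquiv.norm_map]
    gcongr
    exact norm_fderiv_le_of_lipschitz ℝ hL
  rw [← ofReal_norm, ← ofReal_norm, ← ENNReal.ofReal_coe_nnreal,
    ← ENNReal.ofReal_mul (NNReal.coe_nonneg _)]
  exact ENNReal.ofReal_le_ofReal h

theorem aestronglyMeasurable_pullGrad (hT : ContDiff ℝ ∞ T) (hA : AntilipschitzWith L T)
    {g : Space d → Space d} (hg : AEStronglyMeasurable g volume) :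
    AEStronglyMeasurable (pullGrad T g) volume := by
  have h1 := hg.comp_quasiMeasurePreserving
    (quasiMeasurePreserving_of_antilipschitz hA hT.continuous.measurable)
  have h2 : Continuous fun x => (fderiv ℝ T x).adjoint :=
    ContinuousLinearMap.adjoint.continuous.comp (hT.continuous_fderiv (by simp))
  have h3 : Continuous fun p : (Space d →L[ℝ] Space d) × Space d => p.1 p.2 :=
    isBoundedBilinearMap_apply.continuous
  exact h3.comp_aestronglyMeasurable (h2.aestronglyMeasurable.prodMk h1)

/-- In the exponent, `2` comes from `‖DT‖²` and `d` from the distortion of volume. The squared form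
keeps a factor that tends to `1` with `L`. -/
theorem eLpNorm_pullGrad_sq_le (hT : ContDiff ℝ ∞ T) (hL : LipschitzWith L T)
    (hA : AntilipschitzWith L T) {g : Space d → Space d}
    (hg : AEStronglyMeasurable g volume) :
    eLpNorm (pullGrad T g) 2 volume ^ 2 ≤ (L : ℝ≥0∞) ^ (d + 2) * eLpNorm g 2 volume ^ 2 := by
  rw [eLpNorm_two_sq]
  calc ∫⁻ x, ‖pullGrad T g x‖ₑ ^ 2
      ≤ ∫⁻ x, (L : ℝ≥0∞) ^ 2 * ‖g (T x)‖ₑ ^ 2 := by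
        refine lintegral_mono fun x => ?_
        rw [← mul_pow]
        exact pow_le_pow_left' (enorm_pullGrad_le hL g x) 2
    _ = (L : ℝ≥0∞) ^ 2 * eLpNorm (fun x => g (T x)) 2 volume ^ 2 := by
        rw [lintegral_const_mul' _ _ (by simp), eLpNorm_two_sq]
    _ ≤ (L : ℝ≥0∞) ^ 2 * ((L : ℝ≥0∞) ^ d * eLpNorm g 2 volume ^ 2) :=
        mul_le_mul_right (eLpNorm_comp_sq_le hA hT.continuous.measurable hg) _
    _ = _ := by ring

theorem memLp_pullGrad (hT : ContDiff ℝ ∞ T) (hL : LipschitzWith L T)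
    (hA : AntilipschitzWith L T) {g : Space d → Space d} (hg : MemLp g 2 volume) :
    MemLp (pullGrad T g) 2 volume := by
  refine ⟨aestronglyMeasurable_pullGrad hT hA hg.1, ?_⟩
  have h2 : (L : ℝ≥0∞) ^ (d + 2) * eLpNorm g 2 volume ^ 2 < ⊤ :=
    ENNReal.mul_lt_top (ENNReal.pow_lt_top ENNReal.coe_lt_top) (ENNReal.pow_lt_top hg.2)
  exact ((ENNReal.pow_lt_top_iff).1
    ((eLpNorm_pullGrad_sq_le hT hL hA hg.1).trans_lt h2)).resolve_right (by norm_num)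

theorem tendsto_of_sq_le {a b : ℕ → ℝ≥0∞} {c : ℝ≥0∞} (hc : c ≠ ⊤)
    (h : ∀ n, a n ^ 2 ≤ c * b n ^ 2) (hb : Tendsto b atTop (𝓝 0)) :
    Tendsto a atTop (𝓝 0) := by
  have h1 : Tendsto (fun n => c * b n ^ 2) atTop (𝓝 0) := by
    have := ENNReal.Tendsto.const_mul (ENNReal.Tendsto.pow hb (n := 2)) (Or.inr hc) (a := c)
    simpa using this
  have h2 : Tendsto (fun n => a n ^ 2) atTop (𝓝 0) :=
    tendsto_of_tendsto_of_tendsto_of_le_of_le tendsto_const_nhds h1 (fun _ => zero_le) h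
  have h3 := h2.ennrpow_const (1 / 2)
  simp only [ENNReal.zero_rpow_of_pos (one_half_pos (α := ℝ))] at h3
  refine h3.congr fun n => ?_
  rw [← ENNReal.rpow_natCast, ← ENNReal.rpow_mul]
  norm_num

theorem tendsto_comp (hA : AntilipschitzWith L T) (hm : Measurable T)
    {u : Space d → ℝ} {U : ℕ → Space d → ℝ} (hu : MemLp u 2 volume)
    (hU : ∀ n, MemLp (U n) 2 volume)
    (h : Tendsto (fun n => eLpNorm (fun x => u x - U n x) 2 volume) atTop (𝓝 0)) :
    Tendsto (fun n => eLpNorm (fun x => u (T x) - U n (T x)) 2 volume) atTop (𝓝 0) :=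
  tendsto_of_sq_le (c := (L : ℝ≥0∞) ^ d) (by simp) (fun n => eLpNorm_comp_sq_le hA hm
    (w := fun x => u x - U n x) (hu.1.sub (hU n).1)) h

theorem tendsto_pullGrad (hT : ContDiff ℝ ∞ T) (hL : LipschitzWith L T)
    (hA : AntilipschitzWith L T) {g : Space d → Space d} {G : ℕ → Space d → Space d}
    (hg : MemLp g 2 volume) (hG : ∀ n, MemLp (G n) 2 volume)
    (h : Tendsto (fun n => eLpNorm (fun x => g x - G n x) 2 volume) atTop (𝓝 0)) :
    Tendsto (fun n => eLpNorm (fun x => pullGrad T g x - pullGrad T (G n) x) 2 volume)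
      atTop (𝓝 0) := by
  refine tendsto_of_sq_le (c := (L : ℝ≥0∞) ^ (d + 2)) (by simp) (fun n => ?_) h
  have := eLpNorm_pullGrad_sq_le hT hL hA (g := fun x => g x - G n x) (hg.1.sub (hG n).1)
  have e : (fun x => pullGrad T g x - pullGrad T (G n) x) =
      pullGrad T fun x => g x - G n x := by
    ext1 x
    simp [pullGrad]
  rwa [e]

/-- The chain rule in `H¹`. -/
theorem MemH1.comp (hT : ContDiff ℝ ∞ T) (hL : LipschitzWith L T) (hA : AntilipschitzWith L T)
    {u : Space d → ℝ} {g : Space d → Space d} (h : MemH1 u g) :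
    MemH1 (fun x => u (T x)) (pullGrad T g) := by
  -- The chain rule is classical for the smooth approximants, and both sides are continuous in `L²`.
  obtain ⟨φ, hφ, hu, hg⟩ := h.exists_smooth_approx
  have hm := hT.continuous.measurable
  refine memH1_of_tendsto (U := fun n x => φ n (T x)) (G := fun n => pullGrad T (gradient (φ n)))
    (memLp_comp hA hm h.memLp) (memLp_pullGrad hT hL hA h.memLp_grad) (fun n => ?_)
    (tendsto_comp hA hm h.memLp (fun n => (hφ n).2.memLp) hu)
    (tendsto_pullGrad hT hL hA h.memLp_grad (fun n => (hφ n).2.memLp_grad) hg)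
  refine ⟨memLp_comp hA hm (hφ n).2.memLp, memLp_pullGrad hT hL hA (hφ n).2.memLp_grad, ?_⟩
  rw [← gradient_comp hT (hφ n).1]
  exact isWeakGradient_gradient ((hφ n).1.comp hT)

theorem MemH10Tilde.comp (hT : ContDiff ℝ ∞ T) (hL : LipschitzWith L T)
    (hA : AntilipschitzWith L T) {Ω : Set (Space d)}
    {u : Space d → ℝ} {g : Space d → Space d} (h : MemH10Tilde Ω u g) :
    MemH10Tilde (T ⁻¹' Ω) (fun x => u (T x)) (pullGrad T g) where
  memH1 := h.memH1.comp hT hL hA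
  ae_eq_zero := (quasiMeasurePreserving_of_antilipschitz hA hT.continuous.measurable).ae
    h.ae_eq_zero

/-- The approximating test functions are composed with `T`. Their supports stay compact because a
uniformly continuous antilipschitz map is a closed embedding. -/
theorem MemH10.comp (hT : ContDiff ℝ ∞ T) (hL : LipschitzWith L T)
    (hA : AntilipschitzWith L T) {Ω : Set (Space d)}
    {u : Space d → ℝ} {g : Space d → Space d} (h : MemH10 Ω u g) :
    MemH10 (T ⁻¹' Ω) (fun x => u (T x)) (pullGrad T g) where
  memH1 := h.memH1.comp hT hL hA
  mem_closure := by
    obtain ⟨φ, hφ, hu, hg⟩ := h.mem_closure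
    have hH1 := fun n => memH1_of_contDiff_hasCompactSupport (hφ n).1 (hφ n).2.1
    refine ⟨fun n x => φ n (T x), fun n => ⟨(hφ n).1.comp hT, ?_, ?_⟩,
      tendsto_comp hA hT.continuous.measurable h.memH1.memLp (fun n => (hH1 n).memLp) hu, ?_⟩
    · exact (hφ n).2.1.comp_isClosedEmbedding (hA.isClosedEmbedding hL.uniformContinuous)
    · exact (tsupport_comp_subset_preimage (φ n) hT.continuous).trans
        (Set.preimage_mono (hφ n).2.2)
    · simp only [gradient_comp hT (hφ _).1]
      exact tendsto_pullGrad hT hL hA h.memH1.memLp_grad (fun n => (hH1 n).memLp_grad) hg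

end Pullback

/-! ### The `L²` size of `u ∘ T - u` -/

section Deformation

theorem enorm_sub_le_lintegral_gradient {u : Space d → ℝ} (hu : ContDiff ℝ ∞ u)
    (x y : Space d) :
    ‖u y - u x‖ₑ ≤ ‖y - x‖ₑ *
      ∫⁻ t in Set.Ioc (0 : ℝ) 1, ‖gradient u (x + t • (y - x))‖ₑ := by
  have hd : ∀ t : ℝ, HasDerivAt (fun t : ℝ => u (x + t • (y - x)))
      (fderiv ℝ u (x + t • (y - x)) (y - x)) t := by
    intro t
    have h1 : HasDerivAt (fun t : ℝ => x + t • (y - x)) (y - x) t := by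
      simpa using ((hasDerivAt_id t).smul_const (y - x)).const_add x
    exact ((hu.differentiable (by simp)) _).hasFDerivAt.comp_hasDerivAt t h1
  have hc : Continuous fun t : ℝ => fderiv ℝ u (x + t • (y - x)) (y - x) :=
    ((hu.continuous_fderiv (by simp)).comp (by fun_prop)).clm_apply continuous_const
  have h := intervalIntegral.integral_eq_sub_of_hasDerivAt (fun t _ => hd t)
    (hc.intervalIntegrable 0 1)
  simp only [one_smul, add_sub_cancel, zero_smul, add_zero] at h
  rw [← h, intervalIntegral.integral_of_le zero_le_one, ← lintegral_const_mul' _ _ (by simp)]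
  refine (enorm_integral_le_lintegral_enorm _).trans (lintegral_mono fun t => ?_)
  rw [enorm_gradient_eq, mul_comm]
  exact ContinuousLinearMap.le_opENorm _ _

variable {K : ℝ≥0} {T : Space d → Space d} {ε : ℝ≥0}

/-- The difference is an integral of the gradient along the segment from `x` to `T x`. After Jensen
in `t` and Tonelli, each time slice is a composition with `x + t (T x - x)`; this is why all
interpolations, not only `T`, must be antilipschitz. -/
theorem eLpNorm_comp_sub_sq_le_of_smooth (hT : Continuous T) (hε : ∀ x, ‖T x - x‖ₑ ≤ ε)
    (hA : ∀ t ∈ Set.Ioc (0 : ℝ) 1, AntilipschitzWith K fun x => x + t • (T x - x))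
    {u : Space d → ℝ} (hu : ContDiff ℝ ∞ u) :
    eLpNorm (fun x => u (T x) - u x) 2 volume ^ 2 ≤
      (K : ℝ≥0∞) ^ d * (ε : ℝ≥0∞) ^ 2 * eLpNorm (gradient u) 2 volume ^ 2 := by
  have hg := continuous_gradient hu
  have : IsProbabilityMeasure ((volume : Measure ℝ).restrict (Set.Ioc (0 : ℝ) 1)) :=
    ⟨by simp⟩
  have hm : Continuous fun p : Space d × ℝ => gradient u (p.1 + p.2 • (T p.1 - p.1)) := by
    fun_prop
  have hpt : ∀ x, ‖u (T x) - u x‖ₑ ^ 2 ≤ (ε : ℝ≥0∞) ^ 2 *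
      ∫⁻ t in Set.Ioc (0 : ℝ) 1, ‖gradient u (x + t • (T x - x))‖ₑ ^ 2 := by
    intro x
    refine (pow_le_pow_left' (enorm_sub_le_lintegral_gradient hu x (T x)) 2).trans ?_
    rw [mul_pow]
    refine mul_le_mul' (pow_le_pow_left' (hε x) 2) (sq_lintegral_le ?_)
    exact (hm.comp (by fun_prop : Continuous fun t : ℝ => (x, t))).enorm.measurable.aemeasurable
  have hmeas : Measurable (Function.uncurry fun (x : Space d) (t : ℝ) =>
      ‖gradient u (x + t • (T x - x))‖ₑ ^ 2) :=
    (hm.enorm.measurable.pow_const 2 :)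
  rw [eLpNorm_two_sq]
  calc ∫⁻ x, ‖u (T x) - u x‖ₑ ^ 2
      ≤ ∫⁻ x, (ε : ℝ≥0∞) ^ 2 *
        ∫⁻ t in Set.Ioc (0 : ℝ) 1, ‖gradient u (x + t • (T x - x))‖ₑ ^ 2 := lintegral_mono hpt
    _ = (ε : ℝ≥0∞) ^ 2 * ∫⁻ t in Set.Ioc (0 : ℝ) 1, ∫⁻ x,
          ‖gradient u (x + t • (T x - x))‖ₑ ^ 2 := by
        rw [lintegral_const_mul' _ _ (by simp), lintegral_lintegral_swap hmeas.aemeasurable]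
    _ ≤ (ε : ℝ≥0∞) ^ 2 * ∫⁻ t in Set.Ioc (0 : ℝ) 1,
          (K : ℝ≥0∞) ^ d * eLpNorm (gradient u) 2 volume ^ 2 := by
        refine mul_le_mul_right (setLIntegral_mono' measurableSet_Ioc fun t ht => ?_) _
        rw [eLpNorm_two_sq]
        exact lintegral_comp_le (hA t ht) (by fun_prop)
          (hg.enorm.measurable.pow_const 2).aemeasurable
    _ = _ := by
        simp
        ring

/-- Deformations of the identity move `H¹` functions little in `L²`. -/
theorem MemH1.eLpNorm_comp_sub_le (hK : 1 ≤ K) (hT : Continuous T)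
    (hε : ∀ x, ‖T x - x‖ₑ ≤ ε)
    (hA : ∀ t ∈ Set.Ioc (0 : ℝ) 1, AntilipschitzWith K fun x => x + t • (T x - x))
    {u : Space d → ℝ} {g : Space d → Space d} (h : MemH1 u g) :
    eLpNorm (fun x => u (T x) - u x) 2 volume ≤
      (K : ℝ≥0∞) ^ d * ε * eLpNorm g 2 volume := by
  obtain ⟨φ, hφ, hu, hg⟩ := h.exists_smooth_approx
  have hm := hT.measurable
  have hA1 : AntilipschitzWith K T := by
    simpa using hA 1 ⟨zero_lt_one, le_rfl⟩
  have hK1 : (1 : ℝ≥0∞) ≤ (K : ℝ≥0∞) ^ d := one_le_pow_of_one_le' (by exact_mod_cast hK) d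
  -- The bound from splitting through `φ n ∘ T` and `φ n`; its limit is the claimed right-hand side.
  have hlim : Tendsto (fun n => (K : ℝ≥0∞) ^ d * eLpNorm (fun x => u x - φ n x) 2 volume +
      ((K : ℝ≥0∞) ^ d * ε * (eLpNorm g 2 volume +
        eLpNorm (fun x => g x - gradient (φ n) x) 2 volume) +
        eLpNorm (fun x => u x - φ n x) 2 volume)) atTop
      (𝓝 ((K : ℝ≥0∞) ^ d * 0 + ((K : ℝ≥0∞) ^ d * ε * (eLpNorm g 2 volume + 0) + 0))) := by
    refine (ENNReal.Tendsto.const_mul hu (Or.inr (by simp))).add (.add ?_ hu)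
    refine ENNReal.Tendsto.const_mul (tendsto_const_nhds.add hg) (Or.inr ?_)
    exact ENNReal.mul_ne_top (by simp) (by simp)
  have hle := ge_of_tendsto' hlim (b := eLpNorm (fun x => u (T x) - u x) 2 volume) ?_
  · simpa using hle
  intro n
  have m1 : AEStronglyMeasurable (fun x => u x - φ n x) volume :=
    h.memLp.1.sub (hφ n).2.memLp.1
  have m2 : AEStronglyMeasurable (fun x => u (T x) - φ n (T x)) volume :=
    m1.comp_quasiMeasurePreserving (quasiMeasurePreserving_of_antilipschitz hA1 hm)
  have m3 : AEStronglyMeasurable (fun x => φ n (T x) - φ n x) volume :=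
    (((hφ n).1.continuous.comp hT).sub (hφ n).1.continuous).aestronglyMeasurable
  have m4 : AEStronglyMeasurable (fun x => φ n x - u x) volume :=
    (hφ n).2.memLp.1.sub h.memLp.1
  have e : (fun x => u (T x) - u x) = (fun x => u (T x) - φ n (T x)) +
      ((fun x => φ n (T x) - φ n x) + fun x => φ n x - u x) := by
    ext x
    simp
  rw [e]
  refine (eLpNorm_add_le m2 (m3.add m4) (by norm_num)).trans (add_le_add ?_ ?_)
  · exact eLpNorm_comp_le (w := fun x => u x - φ n x) hK hA1 hm m1
  refine (eLpNorm_add_le m3 m4 (by norm_num)).trans (add_le_add ?_ ?_)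
  · have h1 : eLpNorm (gradient (φ n)) 2 volume ≤ eLpNorm g 2 volume +
        eLpNorm (fun x => g x - gradient (φ n) x) 2 volume := by
      have e2 : gradient (φ n) = g - fun x => g x - gradient (φ n) x := by
        ext1 x
        simp
      conv_lhs => rw [e2]
      exact eLpNorm_sub_le h.memLp_grad.1 (h.memLp_grad.1.sub (hφ n).2.memLp_grad.1) (by norm_num)
    refine le_trans ?_ (mul_le_mul_right h1 _)
    rw [← ENNReal.pow_le_pow_left_iff two_ne_zero, mul_pow, mul_pow]
    refine (eLpNorm_comp_sub_sq_le_of_smooth hT hε hA (hφ n).1).trans ?_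
    exact mul_le_mul_left (mul_le_mul_left (le_self_pow hK1 two_ne_zero) _) _
  · exact (eLpNorm_sub_comm (φ n) u 2 volume).le

end Deformation

/-! ### Hölder estimates for functions supported on a set of finite measure -/

section Support

variable {α F : Type*} {mα : MeasurableSpace α} {μ : Measure α} [NormedAddCommGroup F]

/-- `A` is an arbitrary set, so restriction goes through its measurable hull of equal measure. -/
theorem indicator_toMeasurable_ae_eq {A : Set α} {w : α → F}
    (hA : ∀ᵐ x ∂μ, x ∉ A → w x = 0) : (toMeasurable μ A).indicator w =ᵐ[μ] w := by
  filter_upwards [hA] with x hx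
  by_cases h : x ∈ toMeasurable μ A
  · simp [h]
  · simp [h, hx fun h' => h (subset_toMeasurable μ A h')]

/-- Comparison of `Lᵖ` norms for functions supported on a set of finite measure. -/
theorem eLpNorm_le_mul_measure_rpow {A : Set α} {w : α → F} {p q : ℝ≥0∞} (hpq : p ≤ q)
    (hw : AEStronglyMeasurable w μ) (hA : ∀ᵐ x ∂μ, x ∉ A → w x = 0) :
    eLpNorm w p μ ≤ eLpNorm w q μ * μ A ^ (1 / p.toReal - 1 / q.toReal) := by
  have h := eLpNorm_le_eLpNorm_mul_rpow_measure_univ (μ := μ.restrict (toMeasurable μ A)) hpq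
    hw.restrict
  rw [← eLpNorm_indicator_eq_eLpNorm_restrict (measurableSet_toMeasurable μ A),
    ← eLpNorm_indicator_eq_eLpNorm_restrict (measurableSet_toMeasurable μ A),
    eLpNorm_congr_ae (indicator_toMeasurable_ae_eq hA),
    eLpNorm_congr_ae (indicator_toMeasurable_ae_eq hA)] at h
  simpa using h

theorem mul_ae_eq_mul_indicator {A : Set α} {f w : α → ℝ}
    (hA : ∀ᵐ x ∂μ, x ∉ A → w x = 0) :
    (fun x => w x * f x) =ᵐ[μ] fun x => w x * (toMeasurable μ A).indicator f x := by
  filter_upwards [hA] with x hx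
  by_cases h : x ∈ toMeasurable μ A
  · simp [h]
  · simp [hx fun h' => h (subset_toMeasurable μ A h')]

/-- Hölder gives the power `1/2 - 1/p`, which lies in `[0, 1]`. Enlarging the base to `1 + M ≥ 1`
makes the factor uniform in `p`; for `p = ⊤` the conventions `⊤.toReal = 0` and `1 / 0 = 0` give the
correct exponent. -/
theorem eLpNorm_two_indicator_le {A : Set α} {M : ℝ≥0} (hM : μ A ≤ M) {p : ℝ≥0∞}
    (hp : 2 ≤ p) {f : α → ℝ} (hf : AEStronglyMeasurable f μ) :
    eLpNorm ((toMeasurable μ A).indicator f) 2 μ ≤ eLpNorm f p μ * (1 + M) := by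
  have hmA := measurableSet_toMeasurable μ A
  have hb := eLpNorm_le_mul_measure_rpow (A := toMeasurable μ A) hp (hf.indicator hmA)
    (.of_forall fun x hx => by simp [hx])
  have e0 : 0 ≤ 1 / (2 : ℝ≥0∞).toReal - 1 / p.toReal := by
    rcases eq_or_ne p ⊤ with rfl | hpt
    · simp
    · have h2 : (2 : ℝ≥0∞).toReal ≤ p.toReal := ENNReal.toReal_mono hpt hp
      have := one_div_le_one_div_of_le (by simp : 0 < (2 : ℝ≥0∞).toReal) h2
      linarith
  have e1 : 1 / (2 : ℝ≥0∞).toReal - 1 / p.toReal ≤ 1 := by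
    have : 0 ≤ 1 / p.toReal := by positivity
    have h2 : 1 / (2 : ℝ≥0∞).toReal ≤ 1 := by norm_num
    linarith
  have e2 : μ (toMeasurable μ A) ≤ 1 + M := by
    rw [measure_toMeasurable]
    exact hM.trans le_add_self
  refine hb.trans (mul_le_mul' (eLpNorm_indicator_le f) ?_)
  calc _ ≤ (1 + M : ℝ≥0∞) ^ (1 / (2 : ℝ≥0∞).toReal - 1 / p.toReal) :=
        ENNReal.rpow_le_rpow e2 e0
    _ ≤ (1 + M : ℝ≥0∞) ^ (1 : ℝ) := ENNReal.rpow_le_rpow_of_exponent_le le_self_add e1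
    _ = _ := ENNReal.rpow_one _

theorem memLp_two_indicator {A : Set α} {M : ℝ≥0} (hM : μ A ≤ M) {p : ℝ≥0∞}
    (hp : 2 ≤ p) {f : α → ℝ} (hf : MemLp f p μ) :
    MemLp ((toMeasurable μ A).indicator f) 2 μ :=
  ⟨hf.1.indicator (measurableSet_toMeasurable μ A), (eLpNorm_two_indicator_le hM hp hf.1).trans_lt
    (ENNReal.mul_lt_top hf.2 (by simp))⟩

/-- Hölder's inequality for an `L²` function supported on a set of finite measure. -/
theorem integral_mul_bound {A : Set α} {M : ℝ≥0} (hM : μ A ≤ M) {p : ℝ≥0∞} (hp : 2 ≤ p)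
    {f : α → ℝ} (hf : MemLp f p μ) {w : α → ℝ} (hw : MemLp w 2 μ)
    (hA : ∀ᵐ x ∂μ, x ∉ A → w x = 0) :
    Integrable (fun x => w x * f x) μ ∧ |∫ x, w x * f x ∂μ| ≤
      (1 + M) * (eLpNorm f p μ).toReal * (eLpNorm w 2 μ).toReal := by
  have hf2 := memLp_two_indicator hM hp hf
  have hae := mul_ae_eq_mul_indicator (f := f) hA
  refine ⟨(integrable_congr hae).2 (hw.integrable_mul hf2), ?_⟩
  rw [integral_congr_ae hae]
  refine (abs_integral_mul_le hw hf2).trans ?_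
  rw [mul_comm]
  refine mul_le_mul_of_nonneg_right ?_ ENNReal.toReal_nonneg
  have := ENNReal.toReal_mono (ENNReal.mul_lt_top hf.2 (by simp)).ne
    (eLpNorm_two_indicator_le hM hp hf.1)
  rw [ENNReal.toReal_mul] at this
  refine this.trans_eq ?_
  rw [ENNReal.toReal_add (by simp) (by simp)]
  simp [mul_comm]

end Support

/-! ### The Poincaré inequality by averaging over translations -/

section Poincare

theorem MemH1.eLpNorm_translate_sub_le {u : Space d → ℝ} {g : Space d → Space d}
    (h : MemH1 u g) {R : ℝ≥0} {y : Space d} (hy : ‖y‖ₑ ≤ R) :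
    eLpNorm (fun x => u (x - y) - u x) 2 volume ≤ R * eLpNorm g 2 volume := by
  have := h.eLpNorm_comp_sub_le (K := 1) le_rfl (T := fun x => x - y) (ε := R) (by fun_prop)
    (by simpa using hy) (fun t _ => by
      refine AntilipschitzWith.of_le_mul_dist fun a b => ?_
      simp)
  simpa using this

/-- Taking `R ≥ 1` gives `R ≤ R ^ d` since `d ≥ 1`, so a radius linear in `M` is large enough. -/
theorem exists_radius (hd : 1 ≤ d) (M : ℝ≥0) :
    ∃ R : ℝ≥0, 2 * (M : ℝ≥0∞) ≤ volume (Metric.ball (0 : Space d) R) := by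
  have : Nonempty (Fin d) := ⟨⟨0, hd⟩⟩
  set b := volume (Metric.ball (0 : Space d) 1) with hb
  have hb0 : b ≠ 0 := (Metric.measure_ball_pos volume 0 one_pos).ne'
  have hbt : b ≠ ⊤ := measure_ball_lt_top.ne
  set R : ℝ≥0 := 1 + 2 * M / b.toNNReal with hR
  have hRd : R ≤ R ^ d := le_self_pow (by simp [hR]) (by omega)
  refine ⟨R, ?_⟩
  rw [Measure.addHaar_ball _ _ R.coe_nonneg, ← hb, finrank_euclideanSpace_fin,
    ← NNReal.coe_pow, ENNReal.ofReal_coe_nnreal, ← ENNReal.coe_toNNReal hbt]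
  norm_cast
  calc 2 * M = 2 * M / b.toNNReal * b.toNNReal := by
        rw [div_mul_cancel₀]
        exact (ENNReal.toNNReal_ne_zero).2 ⟨hb0, hbt⟩
    _ ≤ R ^ d * b.toNNReal := by
        gcongr
        exact le_add_self.trans hRd

theorem enorm_sq_add_enorm_sq_le (a b : ℝ) :
    ‖a‖ₑ ^ 2 + ‖b‖ₑ ^ 2 ≤ ‖a - b‖ₑ ^ 2 + 2 * (‖a‖ₑ * ‖b‖ₑ) := by
  simp only [← ofReal_norm]
  rw [← ENNReal.ofReal_pow (norm_nonneg _), ← ENNReal.ofReal_pow (norm_nonneg _),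
    ← ENNReal.ofReal_pow (norm_nonneg _), ← ENNReal.ofReal_mul (norm_nonneg _),
    ← ENNReal.ofReal_ofNat 2, ← ENNReal.ofReal_mul (by norm_num),
    ← ENNReal.ofReal_add (by positivity) (by positivity),
    ← ENNReal.ofReal_add (by positivity) (by positivity)]
  refine ENNReal.ofReal_le_ofReal ?_
  rw [← norm_mul]
  simp only [Real.norm_eq_abs, sq_abs]
  nlinarith [le_abs_self (a * b)]

/-- The Poincaré inequality for functions supported on a set of finite measure. -/
theorem MemH1.poincare {u : Space d → ℝ} {g : Space d → Space d} (h : MemH1 u g)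
    {A : Set (Space d)} (hA : ∀ᵐ x ∂(volume : Measure (Space d)), x ∉ A → u x = 0)
    {M R : ℝ≥0} (hM : volume A ≤ M) (hR : 2 * (M : ℝ≥0∞) ≤ volume (Metric.ball (0 : Space d) R)) :
    eLpNorm u 2 volume ≤ R * eLpNorm g 2 volume := by
  set B := Metric.ball (0 : Space d) R with hB
  have hBm : MeasurableSet B := measurableSet_ball
  have hBt : volume B ≠ ⊤ := measure_ball_lt_top.ne
  have hue := h.memLp.1.enorm
  set N := ∫⁻ x, ‖u x‖ₑ ^ 2 with hN
  have hN2 : eLpNorm u 2 volume ^ 2 = N := eLpNorm_two_sq u volume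
  have hNt : N ≠ ⊤ := hN2 ▸ (ENNReal.pow_lt_top h.memLp.2).ne
  set Q := ((R : ℝ≥0∞) * eLpNorm g 2 volume) ^ 2 with hQ
  have hL1 : (∫⁻ x, ‖u x‖ₑ) ^ 2 ≤ N * M := by
    have h1 := eLpNorm_le_mul_measure_rpow (p := 1) (q := 2) (by norm_num) h.memLp.1 hA
    rw [eLpNorm_one_eq_lintegral_enorm] at h1
    refine (pow_le_pow_left' h1 2).trans ?_
    rw [mul_pow, hN2, ← ENNReal.rpow_natCast (_ ^ (_ : ℝ)), ← ENNReal.rpow_mul]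
    norm_num
    exact mul_le_mul_right hM _
  have hux : ∀ y : Space d, AEStronglyMeasurable (fun x => u (x - y)) volume := fun y =>
    h.memLp.1.comp_quasiMeasurePreserving
      (measurePreserving_sub_right volume y).quasiMeasurePreserving
  -- Expanding the square of `u (x - y) - u x`; both square terms integrate to `N` by translation
  -- invariance.
  have hshift : ∀ y ∈ B, 2 * N ≤ Q + 2 * ∫⁻ x, ‖u (x - y)‖ₑ * ‖u x‖ₑ := by
    intro y hy
    have hyR : ‖y‖ₑ ≤ R := by
      rw [← ofReal_norm, ← ENNReal.ofReal_coe_nnreal]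
      exact ENNReal.ofReal_le_ofReal (mem_ball_zero_iff.1 hy).le
    have ht := pow_le_pow_left' (h.eLpNorm_translate_sub_le hyR) 2
    rw [eLpNorm_two_sq] at ht
    have hpt : ∀ x, ‖u (x - y)‖ₑ ^ 2 + ‖u x‖ₑ ^ 2 ≤
        ‖u (x - y) - u x‖ₑ ^ 2 + 2 * (‖u (x - y)‖ₑ * ‖u x‖ₑ) :=
      fun x => enorm_sq_add_enorm_sq_le _ _
    have hmm : AEMeasurable (fun x => 2 * (‖u (x - y)‖ₑ * ‖u x‖ₑ)) volume :=
      ((hux y).enorm.mul hue).const_mul 2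
    have hint := lintegral_mono (μ := volume) hpt
    rw [lintegral_add_right' _ (hue.pow_const 2),
      lintegral_sub_right_eq_self (fun x => ‖u x‖ₑ ^ 2) y,
      lintegral_add_right' _ hmm,
      lintegral_const_mul' _ _ (by norm_num)] at hint
    rw [two_mul N]
    exact hint.trans (add_le_add_left ht _)
  -- Over all `y` the overlap integrates to `‖u‖₁²`, which Cauchy–Schwarz on `A` bounds by `N * M`.
  have hcross : ∫⁻ y in B, ∫⁻ x, ‖u (x - y)‖ₑ * ‖u x‖ₑ ≤ N * M := by
    have hmeas : AEMeasurable (Function.uncurry fun x y : Space d => ‖u (x - y)‖ₑ * ‖u x‖ₑ)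
        (volume.prod volume) :=
      (h.memLp.1.comp_quasiMeasurePreserving
        (quasiMeasurePreserving_sub_of_right_invariant volume volume)).enorm.mul
        (h.memLp.1.comp_quasiMeasurePreserving Measure.quasiMeasurePreserving_fst).enorm
    calc _ ≤ ∫⁻ y, ∫⁻ x, ‖u (x - y)‖ₑ * ‖u x‖ₑ := setLIntegral_le_lintegral _ _
      _ = ∫⁻ x, ∫⁻ y, ‖u (x - y)‖ₑ * ‖u x‖ₑ := (lintegral_lintegral_swap hmeas).symm
      _ = ∫⁻ x, (∫⁻ y, ‖u y‖ₑ) * ‖u x‖ₑ := by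
          refine lintegral_congr fun x => ?_
          rw [lintegral_mul_const' _ _ enorm_ne_top,
            lintegral_sub_left_eq_self (fun y => ‖u y‖ₑ) x]
      _ = (∫⁻ x, ‖u x‖ₑ) ^ 2 := by rw [lintegral_const_mul'' _ hue, sq]
      _ ≤ _ := hL1
  -- As `2 * M ≤ volume B`, the overlap uses only half of the left side; the rest is absorbed
  -- because `N` and `volume B` are finite.
  have hall : 2 * N * volume B ≤ Q * volume B + N * volume B := by
    calc 2 * N * volume B = ∫⁻ y in B, 2 * N := by simp
      _ ≤ ∫⁻ y in B, (Q + 2 * ∫⁻ x, ‖u (x - y)‖ₑ * ‖u x‖ₑ) :=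
          setLIntegral_mono' hBm hshift
      _ = Q * volume B + 2 * ∫⁻ y in B, ∫⁻ x, ‖u (x - y)‖ₑ * ‖u x‖ₑ := by
          rw [lintegral_add_left measurable_const, lintegral_const_mul' _ _ (by norm_num)]
          simp
      _ ≤ Q * volume B + 2 * (N * M) := by gcongr
      _ ≤ Q * volume B + N * volume B := by
          refine add_le_add_right ?_ _
          rw [mul_left_comm]
          exact mul_le_mul_right hR _
  rw [← ENNReal.pow_le_pow_left_iff two_ne_zero, hN2]
  rcases eq_or_ne (volume B) 0 with h0 | h0
  · have hM0 : volume A = 0 := by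
      rw [h0] at hR
      have : (M : ℝ≥0∞) = 0 := by simpa using hR
      exact le_antisymm (this ▸ hM) zero_le
    have hN0 : N = 0 := by
      rw [hN, lintegral_eq_zero_iff' (hue.pow_const 2)]
      filter_upwards [hA, measure_eq_zero_iff_ae_notMem.1 hM0] with x hx hx'
      simp [hx hx']
    simp [hN0]
  · rw [two_mul, add_mul] at hall
    have h3 := (ENNReal.add_le_add_iff_right (ENNReal.mul_ne_top hNt hBt)).1 hall
    exact (ENNReal.mul_le_mul_iff_left h0 hBt).1 h3

end Poincare

/-! ### Existence of minimizers on closed subspaces of `H¹` -/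

section Existence

/-- A quadratic functional with coercive leading part attains its minimum. -/
theorem exists_minimizer_of_coercive {K V : Type*} [NormedAddCommGroup K]
    [InnerProductSpace ℝ K] [CompleteSpace K] [NormedAddCommGroup V] [InnerProductSpace ℝ V]
    (G : K →L[ℝ] V) (l : K →L[ℝ] ℝ) {c : ℝ} (hc : 0 < c)
    (hG : ∀ x, c * ‖x‖ * ‖x‖ ≤ ‖G x‖ ^ 2) :
    ∃ x₀, ∀ x, 1 / 2 * ‖G x₀‖ ^ 2 - l x₀ ≤ 1 / 2 * ‖G x‖ ^ 2 - l x := by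
  let B : K →L[ℝ] K →L[ℝ] ℝ :=
    (isBoundedBilinearMap_inner (𝕜 := ℝ) (E := V)).toContinuousLinearMap.bilinearComp G G
  have hB : ∀ x y, B x y = inner ℝ (G x) (G y) := fun x y => rfl
  have hco : IsCoercive B := ⟨c, hc, fun x => by
    rw [hB, real_inner_self_eq_norm_sq]
    exact hG x⟩
  -- Lax–Milgram solves the Euler–Lagrange equation; completing the square then shows that the
  -- energy excess of `x` is `½ ‖G x₀ - G x‖²`.
  let x₀ := hco.continuousLinearEquivOfBilin.symm ((InnerProductSpace.toDual ℝ K).symm l)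
  have hx₀ : ∀ y, l y = inner ℝ (G x₀) (G y) := by
    intro y
    rw [← hB, ← hco.continuousLinearEquivOfBilin_apply]
    simp [x₀]
  refine ⟨x₀, fun x => ?_⟩
  rw [hx₀, hx₀, real_inner_self_eq_norm_sq]
  have := norm_sub_sq_real (G x₀) (G x)
  nlinarith [sq_nonneg ‖G x₀ - G x‖]

/-- Minimization of `½ ‖y‖² - ⟪φ, x⟫` over a closed subspace of pairs `(x, y)` on which `y`
controls `x`. -/
theorem exists_minimizer_of_isClosed {X Y : Type*} [NormedAddCommGroup X]
    [InnerProductSpace ℝ X] [CompleteSpace X] [NormedAddCommGroup Y] [InnerProductSpace ℝ Y]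
    [CompleteSpace Y] (S : Submodule ℝ (WithLp 2 (X × Y)))
    (hS : IsClosed (S : Set (WithLp 2 (X × Y)))) (φ : X) {R : ℝ}
    (hR : ∀ x ∈ S, ‖x.fst‖ ≤ R * ‖x.snd‖) :
    ∃ x₀ ∈ S, ∀ x ∈ S, 1 / 2 * ‖x₀.snd‖ ^ 2 - inner ℝ φ x₀.fst ≤
      1 / 2 * ‖x.snd‖ ^ 2 - inner ℝ φ x.fst := by
  have : CompleteSpace S := hS.completeSpace_coe
  obtain ⟨x₀, hx₀⟩ := exists_minimizer_of_coercive
    ((WithLp.sndL 2 ℝ X Y).comp S.subtypeL)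
    ((innerSL ℝ φ).comp ((WithLp.fstL 2 ℝ X Y).comp S.subtypeL))
    -- From `‖x‖² = ‖x.fst‖² + ‖x.snd‖² ≤ (R² + 1) ‖x.snd‖²`.
    (c := 1 / (R ^ 2 + 1)) (by positivity) fun x => by
      have h1 := hR x.1 x.2
      have h2 := WithLp.prod_norm_sq_eq_of_L2 x.1
      have h3 := pow_le_pow_left₀ (norm_nonneg _) h1 2
      rw [mul_pow] at h3
      rw [mul_assoc, ← sq, Submodule.coe_norm, h2, one_div, inv_mul_le_iff₀ (by positivity)]
      change _ ≤ (R ^ 2 + 1) * ‖x.1.snd‖ ^ 2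
      linarith
  exact ⟨x₀.1, x₀.2, fun x hx => hx₀ ⟨x, hx⟩⟩

/-- A set of pairs (function, weak gradient) that is a closed subspace of `H¹`. -/
structure IsClosedClass (P : (Space d → ℝ) → (Space d → Space d) → Prop) : Prop where
  memH1 : ∀ {u g}, P u g → MemH1 u g
  zero : P (fun _ => 0) (fun _ => 0)
  add : ∀ {u g u' g'}, P u g → P u' g' → P (fun x => u x + u' x) (fun x => g x + g' x)
  smul : ∀ {u g} (c : ℝ), P u g → P (fun x => c * u x) (fun x => c • g x)
  congr : ∀ {u g u' g'}, P u g → u =ᵐ[volume] u' → g =ᵐ[volume] g' → P u' g'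
  closed : ∀ {u g} {U : ℕ → Space d → ℝ} {G : ℕ → Space d → Space d},
    MemLp u 2 volume → MemLp g 2 volume → (∀ n, P (U n) (G n)) →
    Tendsto (fun n => eLpNorm (fun x => u x - U n x) 2 volume) atTop (𝓝 0) →
    Tendsto (fun n => eLpNorm (fun x => g x - G n x) 2 volume) atTop (𝓝 0) → P u g

variable {P : (Space d → ℝ) → (Space d → Space d) → Prop}

/-- The closed subspace of `L² × L²` of the pairs in a closed class. -/
def IsClosedClass.toSubmodule (hP : IsClosedClass P) :
    Submodule ℝ (WithLp 2 (Lp ℝ 2 (volume : Measure (Space d)) ×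
      Lp (Space d) 2 (volume : Measure (Space d)))) where
  carrier := {x | P x.fst x.snd}
  add_mem' {x y} hx hy := by
    refine hP.congr (hP.add hx hy) ?_ ?_
    · exact (Lp.coeFn_add x.fst y.fst).symm
    · exact (Lp.coeFn_add x.snd y.snd).symm
  zero_mem' := by
    refine hP.congr hP.zero ?_ ?_
    · exact (Lp.coeFn_zero ℝ 2 volume).symm
    · exact (Lp.coeFn_zero (Space d) 2 volume).symm
  smul_mem' c x hx := by
    refine hP.congr (hP.smul c hx) ?_ ?_
    · exact (Lp.coeFn_smul c x.fst).symm
    · exact (Lp.coeFn_smul c x.snd).symm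

theorem IsClosedClass.mem_toSubmodule (hP : IsClosedClass P)
    {x : WithLp 2 (Lp ℝ 2 (volume : Measure (Space d)) ×
      Lp (Space d) 2 (volume : Measure (Space d)))} :
    x ∈ hP.toSubmodule ↔ P x.fst x.snd := Iff.rfl

theorem IsClosedClass.isClosed_toSubmodule (hP : IsClosedClass P) :
    IsClosed (hP.toSubmodule : Set (WithLp 2 (Lp ℝ 2 (volume : Measure (Space d)) ×
      Lp (Space d) 2 (volume : Measure (Space d))))) := by
  refine IsSeqClosed.isClosed fun X x hX hx => ?_
  have h1 : Tendsto (fun n => (X n).fst) atTop (𝓝 x.fst) :=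
    ((WithLp.fstL 2 ℝ _ _).continuous.tendsto x).comp hx
  have h2 : Tendsto (fun n => (X n).snd) atTop (𝓝 x.snd) :=
    ((WithLp.sndL 2 ℝ _ _).continuous.tendsto x).comp hx
  rw [Lp.tendsto_Lp_iff_tendsto_eLpNorm'] at h1 h2
  have h3 := h1.congr fun n => eLpNorm_sub_comm ((X n).fst : Space d → ℝ) x.fst 2 volume
  have h4 := h2.congr fun n => eLpNorm_sub_comm ((X n).snd : Space d → Space d) x.snd 2 volume
  exact hP.closed (u := x.fst) (g := x.snd) (U := fun n => (X n).fst) (G := fun n => (X n).snd)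
    (Lp.memLp x.fst) (Lp.memLp x.snd) hX h3 h4

/-- `f` need not lie in `L²`, but its restriction to the hull of `A` does and gives the same linear
term, which thus becomes an `L²` inner product. Poincaré supplies coercivity. -/
theorem IsClosedClass.exists_minimizer (hP : IsClosedClass P) (hd : 1 ≤ d) {A : Set (Space d)}
    {M : ℝ≥0} (hM : volume A ≤ M)
    (hA : ∀ {u g}, P u g → ∀ᵐ x ∂(volume : Measure (Space d)), x ∉ A → u x = 0)
    {p : ℝ≥0∞} (hp : 2 ≤ p) {f : Space d → ℝ} (hf : MemLp f p volume) :
    ∃ u g, P u g ∧ ∀ u' g', P u' g' → J f u g ≤ J f u' g' := by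
  obtain ⟨R, hR⟩ := exists_radius hd M
  have hf2 := memLp_two_indicator hM hp hf
  have hJ : ∀ {u g} (h : P u g), J f u g =
      1 / 2 * ‖(hP.memH1 h).memLp_grad.toLp g‖ ^ 2 -
        inner ℝ (hf2.toLp _) ((hP.memH1 h).memLp.toLp u) := by
    intro u g h
    rw [J, integral_norm_sq_eq (hP.memH1 h).memLp_grad, Lp.norm_toLp,
      ← integral_mul_eq_inner, integral_congr_ae (mul_ae_eq_mul_indicator (hA h))]
  obtain ⟨x₀, hx₀, hmin⟩ := exists_minimizer_of_isClosed hP.toSubmodule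
    hP.isClosed_toSubmodule (hf2.toLp _) (R := R) fun x hx => by
      rw [hP.mem_toSubmodule] at hx
      have h1 := (hP.memH1 hx).poincare (hA hx) hM hR
      have h2 := ENNReal.toReal_mono
        (ENNReal.mul_ne_top ENNReal.coe_ne_top (Lp.memLp x.snd).2.ne) h1
      rwa [ENNReal.toReal_mul, ← Lp.norm_def, ← Lp.norm_def] at h2
  rw [hP.mem_toSubmodule] at hx₀
  refine ⟨x₀.fst, x₀.snd, hx₀, fun u g hug => ?_⟩
  have hu := (hP.memH1 hug).memLp
  have hg := (hP.memH1 hug).memLp_grad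
  have hmem : WithLp.toLp 2 (hu.toLp u, hg.toLp g) ∈ hP.toSubmodule :=
    hP.mem_toSubmodule.2 <| hP.congr hug hu.coeFn_toLp.symm hg.coeFn_toLp.symm
  rw [hJ hug, hJ hx₀, Lp.toLp_coeFn, Lp.toLp_coeFn]
  have h := hmin _ hmem
  rw [WithLp.toLp_fst, WithLp.toLp_snd] at h
  exact h

theorem isClosedClass_memH10Tilde (Ω : Set (Space d)) : IsClosedClass (MemH10Tilde Ω) where
  memH1 h := h.memH1
  zero := ⟨MemH1.zero, by simp⟩
  add h h' := ⟨h.memH1.add h'.memH1, by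
    filter_upwards [h.ae_eq_zero, h'.ae_eq_zero] with x h1 h2 hx
    simp [h1 hx, h2 hx]⟩
  smul c h := ⟨h.memH1.smul c, by
    filter_upwards [h.ae_eq_zero] with x h1 hx
    simp [h1 hx]⟩
  congr h hu hg := ⟨h.memH1.congr hu hg, by
    filter_upwards [h.ae_eq_zero, hu] with x h1 h2 hx
    rw [← h2, h1 hx]⟩
  closed {u g U G} hu hg h hlu hlg := ⟨memH1_of_tendsto hu hg (fun n => (h n).memH1) hlu hlg, by
    have hlu' : Tendsto (fun n => eLpNorm (U n - u) 2 volume) atTop (𝓝 0) :=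
      hlu.congr fun n => eLpNorm_sub_comm u (U n) 2 volume
    -- A subsequence converges almost everywhere, so vanishing off `Ω` survives the limit.
    obtain ⟨ns, -, hns⟩ := (tendstoInMeasure_of_tendsto_eLpNorm two_ne_zero
      (fun n => (h n).memH1.memLp.1) hu.1 hlu').exists_seq_tendsto_ae
    filter_upwards [hns, ae_all_iff.2 fun n => (h n).ae_eq_zero] with x h1 h2 hx
    exact tendsto_nhds_unique (h1.congr fun i => h2 (ns i) hx) tendsto_const_nhds⟩

theorem MemH10.memH10Tilde {Ω : Set (Space d)} {u : Space d → ℝ} {g : Space d → Space d}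
    (h : MemH10 Ω u g) : MemH10Tilde Ω u g := by
  obtain ⟨φ, hφ, hu, hg⟩ := h.mem_closure
  refine (isClosedClass_memH10Tilde Ω).closed h.memH1.memLp h.memH1.memLp_grad (fun n => ?_) hu hg
  refine ⟨memH1_of_contDiff_hasCompactSupport (hφ n).1 (hφ n).2.1, .of_forall fun x hx => ?_⟩
  exact image_eq_zero_of_notMem_tsupport fun h' => hx ((hφ n).2.2 h')

theorem eLpNorm_sub_le_sub_add_sub {α F : Type*} {m : MeasurableSpace α} {μ : Measure α}
    [NormedAddCommGroup F] {a b c : α → F} (ha : AEStronglyMeasurable a μ)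
    (hb : AEStronglyMeasurable b μ) (hc : AEStronglyMeasurable c μ) :
    eLpNorm (fun x => a x - c x) 2 μ ≤
      eLpNorm (fun x => a x - b x) 2 μ + eLpNorm (fun x => b x - c x) 2 μ := by
  have e : (fun x => a x - c x) = (fun x => a x - b x) + fun x => b x - c x := by
    ext x
    simp
  rw [e]
  exact eLpNorm_add_le (ha.sub hb) (hb.sub hc) (by norm_num)

theorem tendsto_zero_of_le_add {a b c : ℕ → ℝ≥0∞} (h : ∀ n, a n ≤ b n + c n)
    (hb : Tendsto b atTop (𝓝 0)) (hc : Tendsto c atTop (𝓝 0)) : Tendsto a atTop (𝓝 0) := by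
  have := hb.add hc
  rw [add_zero] at this
  exact tendsto_of_tendsto_of_tendsto_of_le_of_le tendsto_const_nhds this (fun _ => zero_le) h

theorem isClosedClass_memH10 (Ω : Set (Space d)) : IsClosedClass (MemH10 Ω) where
  memH1 h := h.memH1
  zero := ⟨MemH1.zero, fun _ _ => 0, fun _ => ⟨contDiff_const, HasCompactSupport.zero, by
    simp [tsupport, Function.support]⟩, by simp, by simp [gradient_fun_const]⟩
  add {u g u' g'} h h' := ⟨h.memH1.add h'.memH1, by
    obtain ⟨φ, hφ, hu, hg⟩ := h.mem_closure
    obtain ⟨φ', hφ', hu', hg'⟩ := h'.mem_closure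
    have m := fun n => memH1_of_contDiff_hasCompactSupport (hφ n).1 (hφ n).2.1
    have m' := fun n => memH1_of_contDiff_hasCompactSupport (hφ' n).1 (hφ' n).2.1
    refine ⟨fun n x => φ n x + φ' n x, fun n => ⟨(hφ n).1.add (hφ' n).1,
      (hφ n).2.1.add (hφ' n).2.1, ?_⟩, ?_, ?_⟩
    · exact (tsupport_add (φ n) (φ' n)).trans (Set.union_subset (hφ n).2.2 (hφ' n).2.2)
    · refine tendsto_zero_of_le_add (fun n => ?_) hu hu'
      have e : (fun x => u x + u' x - (φ n x + φ' n x)) =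
          (fun x => u x - φ n x) + fun x => u' x - φ' n x := by
        ext x
        simp
        ring
      rw [e]
      exact eLpNorm_add_le (h.memH1.memLp.1.sub (m n).memLp.1)
        (h'.memH1.memLp.1.sub (m' n).memLp.1) (by norm_num)
    · refine tendsto_zero_of_le_add (fun n => ?_) hg hg'
      have e : (fun x => g x + g' x - gradient (fun x => φ n x + φ' n x) x) =
          (fun x => g x - gradient (φ n) x) + fun x => g' x - gradient (φ' n) x := by
        ext1 x
        have : gradient (fun x => φ n x + φ' n x) x = gradient (φ n) x + gradient (φ' n) x := by
          simp only [gradient]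
          rw [fderiv_fun_add ((hφ n).1.differentiable (by simp) x)
            ((hφ' n).1.differentiable (by simp) x), map_add]
        simp only [this, Pi.add_apply]
        abel
      rw [e]
      exact eLpNorm_add_le (h.memH1.memLp_grad.1.sub (m n).memLp_grad.1)
        (h'.memH1.memLp_grad.1.sub (m' n).memLp_grad.1) (by norm_num)⟩
  smul {u g} c h := ⟨h.memH1.smul c, by
    obtain ⟨φ, hφ, hu, hg⟩ := h.mem_closure
    refine ⟨fun n x => c * φ n x, fun n => ⟨contDiff_const.mul (hφ n).1,
      (hφ n).2.1.mul_left, ?_⟩, ?_, ?_⟩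
    · exact (closure_mono (Function.support_const_smul_subset c (φ n))).trans (hφ n).2.2
    · have := ENNReal.Tendsto.const_mul hu (Or.inr (enorm_ne_top (x := c)))
      rw [mul_zero] at this
      refine this.congr fun n => ?_
      rw [← eLpNorm_const_smul]
      congr 1
      ext x
      simp
      ring
    · have := ENNReal.Tendsto.const_mul hg (Or.inr (enorm_ne_top (x := c)))
      rw [mul_zero] at this
      refine this.congr fun n => ?_
      rw [← eLpNorm_const_smul]
      congr 1
      ext1 x
      have : gradient (fun x => c * φ n x) x = c • gradient (φ n) x := by
        simp only [gradient]
        rw [fderiv_const_mul ((hφ n).1.differentiable (by simp) x), map_smulₛₗ]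
        simp
      simp [this, smul_sub]⟩
  congr {u g u' g'} h hu hg := ⟨h.memH1.congr hu hg, by
    obtain ⟨φ, hφ, hu', hg'⟩ := h.mem_closure
    refine ⟨φ, hφ, hu'.congr fun n => ?_, hg'.congr fun n => ?_⟩
    · exact eLpNorm_congr_ae (by filter_upwards [hu] with x hx; rw [hx])
    · exact eLpNorm_congr_ae (by filter_upwards [hg] with x hx; rw [hx])⟩
  closed {u g U G} hu hg h hlu hlg := ⟨memH1_of_tendsto hu hg (fun n => (h n).memH1) hlu hlg, by
    have hlim : Tendsto (fun n : ℕ => ((n : ℝ≥0∞) + 1)⁻¹) atTop (𝓝 0) := by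
      have := (tendsto_add_atTop_iff_nat 1).2 ENNReal.tendsto_inv_nat_nhds_zero
      simpa using this
    -- Diagonal choice: one test function within `1 / (n + 1)` of the `n`-th pair.
    have key : ∀ n : ℕ, ∃ φ : Space d → ℝ,
        (ContDiff ℝ ∞ φ ∧ HasCompactSupport φ ∧ tsupport φ ⊆ Ω) ∧
        eLpNorm (fun x => U n x - φ x) 2 volume ≤ ((n : ℝ≥0∞) + 1)⁻¹ ∧
        eLpNorm (fun x => G n x - gradient φ x) 2 volume ≤ ((n : ℝ≥0∞) + 1)⁻¹ := by
      intro n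
      obtain ⟨φ, hφ, h1, h2⟩ := (h n).mem_closure
      have hpos : (0 : ℝ≥0∞) < ((n : ℝ≥0∞) + 1)⁻¹ := by simp
      obtain ⟨k, hk1, hk2⟩ := ((h1.eventually (Iic_mem_nhds hpos)).and
        (h2.eventually (Iic_mem_nhds hpos))).exists
      exact ⟨φ k, hφ k, hk1, hk2⟩
    choose φ hφ hφ1 hφ2 using key
    have m := fun n => memH1_of_contDiff_hasCompactSupport (hφ n).1 (hφ n).2.1
    refine ⟨φ, hφ, tendsto_zero_of_le_add (fun n => ?_) hlu hlim,
      tendsto_zero_of_le_add (fun n => ?_) hlg hlim⟩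
    · exact (eLpNorm_sub_le_sub_add_sub hu.1 (h n).memH1.memLp.1 (m n).memLp.1).trans
        (add_le_add_right (hφ1 n) _)
    · exact (eLpNorm_sub_le_sub_add_sub hg.1 (h n).memH1.memLp_grad.1 (m n).memLp_grad.1).trans
        (add_le_add_right (hφ2 n) _)⟩

end Existence

/-! ### Maps close to the identity in `C¹` -/

section Diffeomorphism

variable {Φ : Space d → Space d} {δ : ℝ≥0}

theorem norm_sub_sub_sub_le (hΦ : ContDiff ℝ ∞ Φ)
    (hδ : ∀ x, ‖fderiv ℝ Φ x - ContinuousLinearMap.id ℝ (Space d)‖ ≤ δ) (x y : Space d) :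
    ‖(Φ x - x) - (Φ y - y)‖ ≤ δ * ‖x - y‖ := by
  have hd : ∀ x, HasFDerivAt (fun x => Φ x - x)
      (fderiv ℝ Φ x - ContinuousLinearMap.id ℝ (Space d)) x := fun x =>
    ((hΦ.differentiable (by simp)) x).hasFDerivAt.sub (hasFDerivAt_id x)
  exact convex_univ.norm_image_sub_le_of_norm_hasFDerivWithin_le
    (fun x _ => (hd x).hasFDerivWithinAt) (fun x _ => hδ x) (Set.mem_univ y) (Set.mem_univ x)

/-- Since `Φ - id` is `δ`-Lipschitz, distances shrink at most by `1 - δ`, and `1 / (1 - δ) ≤ 1 + 2δ`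
for `δ ≤ 1/2`. -/
theorem antilipschitz_interpolation (hΦ : ContDiff ℝ ∞ Φ) (hδ2 : δ ≤ 1 / 2)
    (hδ : ∀ x, ‖fderiv ℝ Φ x - ContinuousLinearMap.id ℝ (Space d)‖ ≤ δ)
    {t : ℝ} (ht : t ∈ Set.Ioc (0 : ℝ) 1) :
    AntilipschitzWith (1 + 2 * δ) fun x => x + t • (Φ x - x) := by
  refine AntilipschitzWith.of_le_mul_dist fun x y => ?_
  have h1 := norm_sub_sub_sub_le hΦ hδ x y
  have hδ' : (δ : ℝ) ≤ 1 / 2 := by exact_mod_cast hδ2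
  have h0 : (0 : ℝ) ≤ δ := δ.coe_nonneg
  simp only [dist_eq_norm]
  have e : x - y = (x + t • (Φ x - x) - (y + t • (Φ y - y))) - t • ((Φ x - x) - (Φ y - y)) := by
    rw [smul_sub t (Φ x - x)]
    abel
  have h2 : ‖t • ((Φ x - x) - (Φ y - y))‖ ≤ δ * ‖x - y‖ := by
    rw [norm_smul, Real.norm_of_nonneg ht.1.le]
    refine (mul_le_of_le_one_left (norm_nonneg _) ht.2).trans h1
  have h3 : ‖x - y‖ ≤ ‖x + t • (Φ x - x) - (y + t • (Φ y - y))‖ + δ * ‖x - y‖ := by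
    conv_lhs => rw [e]
    exact (norm_sub_le _ _).trans (add_le_add_right h2 _)
  push_cast
  have h4 := mul_le_mul_of_nonneg_left h3 (by linarith : (0 : ℝ) ≤ 1 + 2 * δ)
  nlinarith [norm_nonneg (x - y), mul_nonneg (mul_nonneg h0 (norm_nonneg (x - y)))
    (by linarith : (0 : ℝ) ≤ 1 - 2 * δ)]

/-- The constant `1 + δ` would do; `1 + 2δ` matches the antilipschitz constant, so a single number
serves `Φ` and its inverse. -/
theorem lipschitz_of_near_id (hΦ : ContDiff ℝ ∞ Φ)
    (hδ : ∀ x, ‖fderiv ℝ Φ x - ContinuousLinearMap.id ℝ (Space d)‖ ≤ δ) :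
    LipschitzWith (1 + 2 * δ) Φ := by
  refine LipschitzWith.of_dist_le_mul fun x y => ?_
  have h1 := norm_sub_sub_sub_le hΦ hδ x y
  simp only [dist_eq_norm]
  have e : Φ x - Φ y = ((Φ x - x) - (Φ y - y)) + (x - y) := by abel
  rw [e]
  refine (norm_add_le _ _).trans ?_
  push_cast
  nlinarith [norm_nonneg (x - y), mul_nonneg δ.coe_nonneg (norm_nonneg (x - y))]

/-- A smooth map whose derivative is close to the identity is a global diffeomorphism. -/
theorem exists_smooth_inverse (hΦ : ContDiff ℝ ∞ Φ) (hδ2 : δ ≤ 1 / 2)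
    (hδ : ∀ x, ‖fderiv ℝ Φ x - ContinuousLinearMap.id ℝ (Space d)‖ ≤ δ) :
    ∃ Ψ : Space d → Space d, ContDiff ℝ ∞ Ψ ∧ (∀ x, Ψ (Φ x) = x) ∧ ∀ x, Φ (Ψ x) = x := by
  have happ : ApproximatesLinearOn Φ
      ((ContinuousLinearEquiv.refl ℝ (Space d)) : Space d →L[ℝ] Space d) Set.univ δ := by
    intro x _ y _
    have h := norm_sub_sub_sub_le hΦ hδ x y
    have e : Φ x - Φ y - (x - y) = (Φ x - x) - (Φ y - y) := by abel
    simpa [e] using h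
  -- The inverse function theorem on all of space needs `δ < ‖id‖⁻¹`, and `‖id‖ = 1` only on a
  -- nontrivial space.
  have hc : Subsingleton (Space d) ∨
      δ < ‖((ContinuousLinearEquiv.refl ℝ (Space d)).symm : Space d →L[ℝ] Space d)‖₊⁻¹ := by
    rcases subsingleton_or_nontrivial (Space d) with h | h
    · exact Or.inl h
    · right
      have : ‖((ContinuousLinearEquiv.refl ℝ (Space d)).symm : Space d →L[ℝ] Space d)‖₊ = 1 := by
        have h1 : ‖ContinuousLinearMap.id ℝ (Space d)‖ = 1 := ContinuousLinearMap.norm_id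
        exact NNReal.eq h1
      rw [this, inv_one]
      exact hδ2.trans_lt (by rw [div_lt_one] <;> norm_num)
  let H := ApproximatesLinearOn.toHomeomorph Φ happ hc
  have hH : ∀ x, H x = Φ x := fun x => rfl
  have hu : ∀ x, ‖(1 : Space d →L[ℝ] Space d) - fderiv ℝ Φ x‖ < 1 := fun x => by
    rw [norm_sub_rev]
    refine (hδ x).trans_lt ?_
    have hδ' : (δ : ℝ) ≤ 1 / 2 := by exact_mod_cast hδ2
    linarith
  -- Each derivative is invertible by the Neumann series, which makes the inverse homeomorphism
  -- smooth.
  let D : Space d → Space d ≃L[ℝ] Space d := fun x =>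
    ContinuousLinearEquiv.unitsEquiv ℝ (Space d) (Units.oneSub _ (hu x))
  have hD : ∀ x, HasFDerivAt H (D x : Space d →L[ℝ] Space d) x := fun x => by
    have e : (D x : Space d →L[ℝ] Space d) = fderiv ℝ Φ x := by
      ext1 v
      simp [D]
    rw [e]
    exact ((hΦ.differentiable (by simp)) x).hasFDerivAt
  exact ⟨H.symm, H.contDiff_symm hD hΦ, fun x => H.symm_apply_apply x,
    fun x => H.apply_symm_apply x⟩

end Diffeomorphism

/-! ### Change of `J` under `u ↦ u ∘ T` -/

section Comparison

/-- The convex function `(1 + t) ^ n` lies below its chord on `[0, 1]`. -/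
theorem one_add_pow_le {t : ℝ} (h0 : 0 ≤ t) (h1 : t ≤ 1) (n : ℕ) :
    (1 + t) ^ n ≤ 1 + (2 ^ n - 1) * t := by
  induction n with
  | zero => simp
  | succ n ih =>
    have h2 : (1 : ℝ) ≤ 2 ^ n := one_le_pow₀ (by norm_num)
    rw [pow_succ, pow_succ]
    have := mul_le_mul_of_nonneg_right ih (by linarith : 0 ≤ 1 + t)
    nlinarith [mul_nonneg (mul_nonneg (by linarith : (0 : ℝ) ≤ 2 ^ n - 1) h0)
      (by linarith : 0 ≤ 1 - t)]

/-- The constant in the comparison of energies, in terms of the dimension, a bound `M` for the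
measure of the support, and a Poincaré constant `R`. -/
noncomputable def comparisonConst (d : ℕ) (M R : ℝ≥0) : ℝ≥0 :=
  2 ^ (d + 3) * (1 + (M + 2 ^ d * M)) ^ 2 * R ^ 2 + 2 * (1 + (M + 2 ^ d * M)) ^ 2 * 4 ^ d * R

theorem J_comp_le {T : Space d → Space d} {t ε : ℝ≥0} (ht : t ≤ 1) (hT : ContDiff ℝ ∞ T)
    (hL : LipschitzWith (1 + t) T) (hA : AntilipschitzWith (1 + t) T)
    (hdef : ∀ {u : Space d → ℝ} {g : Space d → Space d}, MemH1 u g →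
      eLpNorm (fun x => u (T x) - u x) 2 volume ≤ (4 : ℝ≥0∞) ^ d * ε * eLpNorm g 2 volume)
    {A : Set (Space d)} {M R : ℝ≥0} (hM : volume A ≤ M)
    (hR : 2 * (M : ℝ≥0∞) ≤ volume (Metric.ball (0 : Space d) R))
    {p : ℝ≥0∞} (hp : 2 ≤ p) {f : Space d → ℝ} (hf : MemLp f p volume)
    {u : Space d → ℝ} {g : Space d → Space d} (h : MemH10Tilde A u g) (hJ : J f u g ≤ 0) :
    J f (fun x => u (T x)) (pullGrad T g) ≤ J f u g +
      comparisonConst d M R * (eLpNorm f p volume).toReal ^ 2 * (ε + t) := by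
  have h' := h.comp hT hL hA
  set S := A ∪ T ⁻¹' A with hS
  have hSM : volume S ≤ ((M + 2 ^ d * M : ℝ≥0) : ℝ≥0∞) := by
    -- `S` carries both `u` and `u ∘ T`; the preimage has at most `2 ^ d` times the volume because
    -- `1 + t ≤ 2`.
    refine (measure_union_le _ _).trans ?_
    push_cast
    refine add_le_add hM ((volume_preimage_le hA A).trans (mul_le_mul' ?_ hM))
    refine pow_le_pow_left' ?_ d
    norm_cast
    calc 1 + t ≤ 1 + 1 := by gcongr
      _ = 2 := by norm_num
  have hu0 : ∀ᵐ x ∂(volume : Measure (Space d)), x ∉ S → u x = 0 := by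
    filter_upwards [h.ae_eq_zero] with x hx hxS
    exact hx fun hh => hxS (Or.inl hh)
  have hv0 : ∀ᵐ x ∂(volume : Measure (Space d)), x ∉ S → u (T x) = 0 := by
    filter_upwards [h'.ae_eq_zero] with x hx hxS
    exact hx fun hh => hxS (Or.inr hh)
  have hw0 : ∀ᵐ x ∂(volume : Measure (Space d)), x ∉ S → u (T x) - u x = 0 := by
    filter_upwards [hu0, hv0] with x h1 h2 hxS
    rw [h1 hxS, h2 hxS, sub_zero]
  have bu := integral_mul_bound hSM hp hf h.memH1.memLp hu0
  have bv := integral_mul_bound hSM hp hf h'.memH1.memLp hv0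
  have bw := (integral_mul_bound hSM hp hf (h'.memH1.memLp.sub h.memH1.memLp) hw0).2
  have hgt := h.memH1.memLp_grad.2.ne
  set a := (eLpNorm g 2 volume).toReal with ha
  set N := (eLpNorm f p volume).toReal with hN
  set B : ℝ≥0 := 1 + (M + 2 ^ d * M) with hB
  have hBc : (1 : ℝ) + ((M + 2 ^ d * M : ℝ≥0) : ℝ) = B := by simp [hB]
  rw [hBc] at bu bv bw
  have hpo : (eLpNorm u 2 volume).toReal ≤ R * a := by
    have := ENNReal.toReal_mono (ENNReal.mul_ne_top ENNReal.coe_ne_top hgt)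
      (h.memH1.poincare h.ae_eq_zero hM hR)
    rwa [ENNReal.toReal_mul] at this
  have hdf : (eLpNorm (fun x => u (T x) - u x) 2 volume).toReal ≤ 4 ^ d * ε * a := by
    have := ENNReal.toReal_mono (ENNReal.mul_ne_top (ENNReal.mul_ne_top (by simp)
      ENNReal.coe_ne_top) hgt) (hdef h.memH1)
    simpa [ENNReal.toReal_mul] using this
  have hgr : ∫ x, ‖pullGrad T g x‖ ^ 2 ≤ (1 + 2 ^ (d + 2) * t) * a ^ 2 := by
    rw [integral_norm_sq_eq h'.memH1.memLp_grad, ← ENNReal.toReal_pow]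
    have := ENNReal.toReal_mono (ENNReal.mul_ne_top (by simp) (ENNReal.pow_ne_top hgt))
      (eLpNorm_pullGrad_sq_le hT hL hA h.memH1.memLp_grad.1)
    refine this.trans ?_
    rw [ENNReal.toReal_mul, ENNReal.toReal_pow, ENNReal.toReal_pow, ENNReal.coe_toReal]
    refine mul_le_mul_of_nonneg_right ?_ (sq_nonneg _)
    push_cast
    refine (one_add_pow_le t.coe_nonneg (by exact_mod_cast ht) (d + 2)).trans ?_
    nlinarith [t.coe_nonneg]
  have ha0 : 0 ≤ a := ENNReal.toReal_nonneg
  have hN0 : 0 ≤ N := ENNReal.toReal_nonneg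
  have hR0 : (0 : ℝ) ≤ R := R.coe_nonneg
  have hB0 : (0 : ℝ) ≤ B := B.coe_nonneg
  have ht0 : (0 : ℝ) ≤ t := t.coe_nonneg
  have he0 : (0 : ℝ) ≤ ε := ε.coe_nonneg
  have hJu : J f u g = 1 / 2 * a ^ 2 - ∫ x, u x * f x := by
    rw [J, integral_norm_sq_eq h.memH1.memLp_grad]
  -- `J f u g ≤ 0` gives `½ a² ≤ ∫ u f ≤ B N R a`; divide by `a` unless it vanishes.
  have haN : a ≤ 2 * B * N * R := by
    have h1 : 1 / 2 * a ^ 2 ≤ B * N * (R * a) := by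
      have h2 := (le_abs_self _).trans bu.2
      have h3 := mul_le_mul_of_nonneg_left hpo (mul_nonneg hB0 hN0)
      linarith
    rcases ha0.eq_or_lt with h0 | h0
    · rw [← h0]
      positivity
    · refine le_of_mul_le_mul_right ?_ h0
      linarith
  have hint : ∫ x, u (T x) * f x = (∫ x, u x * f x) + ∫ x, (u (T x) - u x) * f x := by
    rw [← integral_add bu.1]
    · congr 1
      ext x
      ring
    · refine (bv.1.sub bu.1).congr (.of_forall fun x => ?_)
      simp only [Pi.sub_apply]
      ring
  have bw' : -(∫ x, (u (T x) - u x) * f x) ≤ B * N * (4 ^ d * ε * a) :=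
    (neg_le_abs _).trans (bw.trans (mul_le_mul_of_nonneg_left hdf (mul_nonneg hB0 hN0)))
  have hsq : a ^ 2 ≤ (2 * B * N * R) ^ 2 := pow_le_pow_left₀ ha0 haN 2
  have k1 : 2 ^ (d + 1) * t * a ^ 2 ≤ 2 ^ (d + 1) * t * (2 * B * N * R) ^ 2 :=
    mul_le_mul_of_nonneg_left hsq (by positivity)
  have k2 : B * N * (4 ^ d * ε * a) ≤ B * N * (4 ^ d * ε * (2 * B * N * R)) := by gcongr
  rw [hJu, J, hint]
  -- The first summand is `½ · 2^(d+2) · (2BR)²` from the gradient, the second `B · 4^d · 2BR` from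
  -- the linear term. The cross terms `k3` and `k4` are added to factor out `ε + t`.
  have hC : (comparisonConst d M R : ℝ) = 2 ^ (d + 3) * B ^ 2 * R ^ 2 + 2 * B ^ 2 * 4 ^ d * R := by
    simp [comparisonConst, hB]
  rw [hC]
  have k3 : 0 ≤ 2 ^ (d + 3) * (B : ℝ) ^ 2 * R ^ 2 * N ^ 2 * ε := by positivity
  have k4 : 0 ≤ 2 * (B : ℝ) ^ 2 * 4 ^ d * R * N ^ 2 * t := by positivity
  have p1 : (2 : ℝ) ^ (d + 2) = 2 * 2 ^ (d + 1) := by ring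
  have p2 : (2 : ℝ) ^ (d + 3) = 4 * 2 ^ (d + 1) := by ring
  rw [p1] at hgr
  rw [p2] at k3 ⊢
  linarith

end Comparison

/-! ### Two-sided stability of the energies -/

section Energy

/-- The values of `J f` on a class of pairs. -/
def classValues (f : Space d → ℝ) (P : (Space d → ℝ) → (Space d → Space d) → Prop) : Set ℝ :=
  {e | ∃ u g, P u g ∧ e = J f u g}

theorem J_zero (f : Space d → ℝ) : J f (fun _ => 0) (fun _ => 0) = 0 := by
  simp [J]

variable {P P' : (Space d → ℝ) → (Space d → Space d) → Prop}
  {A A' : Set (Space d)} {M R : ℝ≥0} {p : ℝ≥0∞} {f : Space d → ℝ}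

theorem IsClosedClass.isLeast_sInf (hP : IsClosedClass P) (hd : 1 ≤ d) (hM : volume A ≤ M)
    (hA : ∀ {u g}, P u g → MemH10Tilde A u g) (hp : 2 ≤ p) (hf : MemLp f p volume) :
    IsLeast (classValues f P) (sInf (classValues f P)) := by
  obtain ⟨u, g, hug, hmin⟩ := hP.exists_minimizer hd hM (fun h => (hA h).ae_eq_zero) hp hf
  have h : IsLeast (classValues f P) (J f u g) := by
    refine ⟨⟨u, g, hug, rfl⟩, ?_⟩
    rintro _ ⟨u', g', h', rfl⟩
    exact hmin u' g' h'
  rwa [h.csInf_eq]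

/-- This settles the case `0 · ∞ = 0`: both energies vanish, even if `Φ - id` is unbounded. -/
theorem IsClosedClass.sInf_eq_zero (hP : IsClosedClass P) (hf : f =ᵐ[volume] 0) :
    sInf (classValues f P) = 0 := by
  refine IsLeast.csInf_eq ⟨⟨_, _, hP.zero, (J_zero f).symm⟩, ?_⟩
  rintro _ ⟨u, g, -, rfl⟩
  have : ∫ x, u x * f x = 0 := by
    refine integral_eq_zero_of_ae ?_
    filter_upwards [hf] with x hx
    simp [hx]
  rw [J, this]
  have : 0 ≤ ∫ x, ‖g x‖ ^ 2 := integral_nonneg fun x => by positivity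
  linarith

theorem sInf_le_of_comp (hP : IsClosedClass P)
    (hl : IsLeast (classValues f P) (sInf (classValues f P)))
    (hl' : IsLeast (classValues f P') (sInf (classValues f P')))
    (hA : ∀ {u g}, P u g → MemH10Tilde A u g)
    {T : Space d → Space d} (hPP' : ∀ {u g}, P u g → P' (fun x => u (T x)) (pullGrad T g))
    {t ε : ℝ≥0} (ht : t ≤ 1) (hT : ContDiff ℝ ∞ T)
    (hL : LipschitzWith (1 + t) T) (hAn : AntilipschitzWith (1 + t) T)
    (hdef : ∀ {u : Space d → ℝ} {g : Space d → Space d}, MemH1 u g →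
      eLpNorm (fun x => u (T x) - u x) 2 volume ≤ (4 : ℝ≥0∞) ^ d * ε * eLpNorm g 2 volume)
    (hM : volume A ≤ M) (hR : 2 * (M : ℝ≥0∞) ≤ volume (Metric.ball (0 : Space d) R))
    (hp : 2 ≤ p) (hf : MemLp f p volume) :
    sInf (classValues f P') ≤ sInf (classValues f P) +
      comparisonConst d M R * (eLpNorm f p volume).toReal ^ 2 * (ε + t) := by
  obtain ⟨u, g, hug, he⟩ := hl.1
  have h0 : J f u g ≤ 0 := by
    rw [← he]
    exact hl.2 ⟨_, _, hP.zero, (J_zero f).symm⟩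
  rw [he]
  exact (hl'.2 ⟨_, _, hPP' hug, rfl⟩).trans
    (J_comp_le ht hT hL hAn hdef hM hR hp hf (hA hug) h0)

/-- Stability of the energy under a deformation, for corresponding closed classes. -/
theorem stability (hd : 1 ≤ d) {m : ℝ≥0} (hm : volume A ≤ m)
    (hR : 2 * ((2 ^ d * m : ℝ≥0) : ℝ≥0∞) ≤ volume (Metric.ball (0 : Space d) R))
    (hp : 2 ≤ p) (hf : MemLp f p volume) {Φ : Space d → Space d} (hΦ : ContDiff ℝ ∞ Φ)
    (hΦ2 : ∀ x, ‖fderiv ℝ Φ x - ContinuousLinearMap.id ℝ (Space d)‖ ≤ 1 / 2)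
    {Q : Set (Space d) → (Space d → ℝ) → (Space d → Space d) → Prop}
    (hQ : ∀ Ω, IsClosedClass (Q Ω)) (hQA : ∀ {Ω u g}, Q Ω u g → MemH10Tilde Ω u g)
    (hcomp : ∀ {L : ℝ≥0} {T : Space d → Space d}, ContDiff ℝ ∞ T → LipschitzWith L T →
      AntilipschitzWith L T → ∀ {Ω u g}, Q Ω u g → Q (T ⁻¹' Ω) (fun x => u (T x)) (pullGrad T g)) :
    IsLeast (classValues f (Q A)) (sInf (classValues f (Q A))) ∧
    IsLeast (classValues f (Q (Φ '' A))) (sInf (classValues f (Q (Φ '' A)))) ∧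
    ENNReal.ofReal |sInf (classValues f (Q (Φ '' A))) - sInf (classValues f (Q A))| ≤
      ((2 * comparisonConst d (2 ^ d * m) R + 1 : ℝ≥0) : ℝ≥0∞) * eLpNorm f p volume ^ 2 *
        c1Norm (fun x => Φ x - x) := by
  have hfd : ∀ x, fderiv ℝ (fun x => Φ x - x) x =
      fderiv ℝ Φ x - ContinuousLinearMap.id ℝ (Space d) := fun x =>
    (((hΦ.differentiable (by simp)) x).hasFDerivAt.sub (hasFDerivAt_id x)).fderiv
  set e₁ := ⨆ x, ‖Φ x - x‖ₑ with he₁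
  set e₂ := ⨆ x, ‖fderiv ℝ (fun x => Φ x - x) x‖ₑ with he₂
  have he₂2 : e₂ ≤ ((1 / 2 : ℝ≥0) : ℝ≥0∞) := by
    refine iSup_le fun x => ?_
    rw [hfd]
    exact enorm_le_coe.2 (by exact_mod_cast hΦ2 x)
  lift e₂ to ℝ≥0 using ne_top_of_le_ne_top ENNReal.coe_ne_top he₂2 with δ hδe
  have hδ2 : δ ≤ 1 / 2 := by exact_mod_cast he₂2
  have hδ : ∀ x, ‖fderiv ℝ Φ x - ContinuousLinearMap.id ℝ (Space d)‖ ≤ δ := fun x => by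
    have h1 : ‖fderiv ℝ (fun x => Φ x - x) x‖ₑ ≤ δ := by
      rw [he₂]
      exact le_iSup (fun x => ‖fderiv ℝ (fun x => Φ x - x) x‖ₑ) x
    rw [hfd] at h1
    exact_mod_cast enorm_le_coe.1 h1
  have ht : 2 * δ ≤ 1 := by
    calc 2 * δ ≤ 2 * (1 / 2) := by gcongr
      _ = 1 := by norm_num
  obtain ⟨Ψ, hΨ, hΨΦ, hΦΨ⟩ := exists_smooth_inverse hΦ hδ2 hδ
  have hΦL := lipschitz_of_near_id hΦ hδ
  have hΦA : AntilipschitzWith (1 + 2 * δ) Φ := by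
    simpa using antilipschitz_interpolation hΦ hδ2 hδ (t := 1) ⟨one_pos, le_rfl⟩
  have hΨL : LipschitzWith (1 + 2 * δ) Ψ := hΦA.to_rightInverse hΦΨ
  have hΨA : AntilipschitzWith (1 + 2 * δ) Ψ := hΦL.to_rightInverse hΦΨ
  have him : Φ '' A = Ψ ⁻¹' A := by
    ext x
    exact ⟨fun ⟨y, hy, hyx⟩ => by rw [← hyx, Set.mem_preimage, hΨΦ]; exact hy,
      fun hx => ⟨Ψ x, hx, hΦΨ x⟩⟩
  have him' : Φ ⁻¹' (Φ '' A) = A := by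
    rw [him]
    ext x
    simp [hΨΦ]
  have h2K : (1 + 2 * δ : ℝ≥0) ≤ 2 := by
    calc 1 + 2 * δ ≤ 1 + 1 := by gcongr
      _ = 2 := by norm_num
  -- A common volume bound for `A` and `Φ '' A`, so one constant serves both directions.
  set M : ℝ≥0 := 2 ^ d * m with hMdef
  have hAM : volume A ≤ M := hm.trans (ENNReal.coe_le_coe.2
    (le_mul_of_one_le_left zero_le (one_le_pow₀ one_le_two)))
  have hA'M : volume (Φ '' A) ≤ M := by
    rw [him, hMdef, ENNReal.coe_mul, ENNReal.coe_pow]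
    exact (volume_preimage_le hΨA A).trans
      (mul_le_mul' (pow_le_pow_left' (ENNReal.coe_le_coe.2 h2K) d) hm)
  have hl := (hQ A).isLeast_sInf hd hAM hQA hp hf
  have hl' := (hQ (Φ '' A)).isLeast_sInf hd hA'M hQA hp hf
  refine ⟨hl, hl', ?_⟩
  have hc1 : c1Norm (fun x => Φ x - x) = e₁ + δ := by rw [c1Norm, hδe]
  rcases eq_or_ne (eLpNorm f p volume) 0 with hf0 | hf0
  · have hfz := (eLpNorm_eq_zero_iff hf.1 (two_pos.trans_le hp).ne').1 hf0
    simp [(hQ _).sInf_eq_zero hfz]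
  rcases eq_or_ne e₁ ⊤ with het | het
  -- The right side is infinite once its first factor is nonzero, which the summand `1` in the
  -- constant ensures.
  · rw [hc1, het, top_add, ENNReal.mul_top]
    · exact le_top
    · exact mul_ne_zero (by simp) (pow_ne_zero 2 hf0)
  lift e₁ to ℝ≥0 using het with ε hεe
  have hε : ∀ x, ‖Φ x - x‖ₑ ≤ ε := fun x => by
    rw [he₁]
    exact le_iSup (fun x => ‖Φ x - x‖ₑ) x
  have hK1 : (1 : ℝ≥0) ≤ 1 + 2 * δ := le_self_add
  have h2K' : ((1 + 2 * δ : ℝ≥0) : ℝ≥0∞) ≤ 2 := by exact_mod_cast h2K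
  have hdefΦ : ∀ {u : Space d → ℝ} {g : Space d → Space d}, MemH1 u g →
      eLpNorm (fun x => u (Φ x) - u x) 2 volume ≤ (2 : ℝ≥0∞) ^ d * ε * eLpNorm g 2 volume := by
    intro u g hug
    refine (hug.eLpNorm_comp_sub_le hK1 hΦ.continuous hε
      (fun t ht => antilipschitz_interpolation hΦ hδ2 hδ ht)).trans ?_
    gcongr
  have hdefΦ' : ∀ {u : Space d → ℝ} {g : Space d → Space d}, MemH1 u g →
      eLpNorm (fun x => u (Φ x) - u x) 2 volume ≤ (4 : ℝ≥0∞) ^ d * ε * eLpNorm g 2 volume := by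
    intro u g hug
    refine (hdefΦ hug).trans ?_
    gcongr
    norm_num
  have hdefΨ : ∀ {u : Space d → ℝ} {g : Space d → Space d}, MemH1 u g →
      eLpNorm (fun x => u (Ψ x) - u x) 2 volume ≤ (4 : ℝ≥0∞) ^ d * ε * eLpNorm g 2 volume := by
    intro u g hug
    -- Composing `u ∘ Φ - u` with `Ψ` yields `u - u ∘ Ψ`; the second factor `2 ^ d` turns the
    -- constant into `4 ^ d`.
    have hw : AEStronglyMeasurable (fun x => u (Φ x) - u x) volume :=
      (memLp_comp hΦA hΦ.continuous.measurable hug.memLp).1.sub hug.memLp.1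
    have h1 := eLpNorm_comp_le hK1 hΨA hΨ.continuous.measurable hw
    simp only [hΦΨ] at h1
    calc eLpNorm (fun x => u (Ψ x) - u x) 2 volume
        = eLpNorm (fun x => u x - u (Ψ x)) 2 volume := eLpNorm_sub_comm (fun x => u (Ψ x)) u _ _
      _ ≤ (2 : ℝ≥0∞) ^ d * ((2 : ℝ≥0∞) ^ d * ε * eLpNorm g 2 volume) := by
          refine h1.trans (mul_le_mul' (pow_le_pow_left' h2K' d) (hdefΦ hug))
      _ = _ := by
          rw [show (4 : ℝ≥0∞) = 2 * 2 by norm_num, mul_pow]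
          ring
  have hup := sInf_le_of_comp (hQ A) hl hl' hQA (T := Ψ)
    (fun h => him ▸ hcomp hΨ hΨL hΨA h) ht hΨ hΨL hΨA hdefΨ hAM hR hp hf
  have hlo := sInf_le_of_comp (hQ (Φ '' A)) hl' hl hQA (T := Φ)
    (fun {u g} h => by
      have := hcomp hΦ hΦL hΦA h
      rwa [him'] at this) ht hΦ hΦL hΦA hdefΦ' hA'M hR hp hf
  set C := comparisonConst d M R
  -- The comparison was applied with `t = 2δ`, whence the factor `2` on `C`.
  have habs : |sInf (classValues f (Q (Φ '' A))) - sInf (classValues f (Q A))| ≤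
      (2 * C + 1) * (eLpNorm f p volume).toReal ^ 2 * (ε + δ) := by
    have h1 : (C : ℝ) * (eLpNorm f p volume).toReal ^ 2 * (ε + (2 * δ : ℝ≥0)) ≤
        (2 * C + 1) * (eLpNorm f p volume).toReal ^ 2 * (ε + δ) := by
      push_cast
      have k1 : 0 ≤ (C : ℝ) * (eLpNorm f p volume).toReal ^ 2 * ε := by positivity
      have k2 : 0 ≤ (eLpNorm f p volume).toReal ^ 2 * ((ε : ℝ) + δ) := by positivity
      linarith
    rw [abs_le]
    constructor <;> linarith
  rw [hc1]
  refine (ENNReal.ofReal_le_ofReal habs).trans_eq ?_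
  rw [ENNReal.ofReal_mul (by positivity), ENNReal.ofReal_mul (by positivity),
    ENNReal.ofReal_pow ENNReal.toReal_nonneg, ENNReal.ofReal_toReal hf.2.ne]
  congr 2
  · rw [← ENNReal.ofReal_coe_nnreal]
    simp
  · rw [← ENNReal.coe_add, ← ENNReal.ofReal_coe_nnreal, NNReal.coe_add]

end Energy

end DirichletEnergy

/-! ### The stability theorem for both energies -/

theorem lemma4p2 (d : ℕ) (hd : 1 ≤ d) (m : ℝ≥0) :
    ∃ C : ℝ≥0, ∀ (Ω : Set (EuclideanSpace ℝ (Fin d))),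
      NullMeasurableSet Ω volume → volume Ω = (m : ℝ≥0∞) →
      ∀ (p : ℝ≥0∞), 2 ≤ p →
      ∀ (f : EuclideanSpace ℝ (Fin d) → ℝ), MemLp f p volume →
      ∀ (Φ : EuclideanSpace ℝ (Fin d) → EuclideanSpace ℝ (Fin d)), ContDiff ℝ ∞ Φ →
      (∀ x, ‖fderiv ℝ Φ x - ContinuousLinearMap.id ℝ (EuclideanSpace ℝ (Fin d))‖ ≤ 1 / 2) →
      (IsOpen Ω →
        IsLeast (DirichletEnergy.values f Ω) (DirichletEnergy.energy f Ω) ∧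
        IsLeast (DirichletEnergy.values f (Φ '' Ω)) (DirichletEnergy.energy f (Φ '' Ω)) ∧
        ENNReal.ofReal |DirichletEnergy.energy f (Φ '' Ω) - DirichletEnergy.energy f Ω| ≤
          C * eLpNorm f p volume ^ 2 * DirichletEnergy.c1Norm (fun x => Φ x - x)) ∧
      (IsLeast (DirichletEnergy.valuesTilde f Ω) (DirichletEnergy.energyTilde f Ω) ∧
        IsLeast (DirichletEnergy.valuesTilde f (Φ '' Ω))
          (DirichletEnergy.energyTilde f (Φ '' Ω)) ∧
        ENNReal.ofReal
            |DirichletEnergy.energyTilde f (Φ '' Ω) - DirichletEnergy.energyTilde f Ω| ≤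
          C * eLpNorm f p volume ^ 2 * DirichletEnergy.c1Norm (fun x => Φ x - x)) := by
  -- The Poincaré radius is fixed before `Ω`, `p`, `f` and `Φ`, so the constant depends on `d` and
  -- `m` only.
  obtain ⟨R, hR⟩ := DirichletEnergy.exists_radius hd (2 ^ d * m)
  refine ⟨2 * DirichletEnergy.comparisonConst d (2 ^ d * m) R + 1,
    fun Ω _ hΩ p hp f hf Φ hΦ hΦ2 => ⟨fun _ => ?_, ?_⟩⟩
  · exact DirichletEnergy.stability hd hΩ.le hR hp hf hΦ hΦ2
      DirichletEnergy.isClosedClass_memH10 DirichletEnergy.MemH10.memH10Tilde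
      (fun hT hL hA => DirichletEnergy.MemH10.comp hT hL hA)
  · exact DirichletEnergy.stability hd hΩ.le hR hp hf hΦ hΦ2
      DirichletEnergy.isClosedClass_memH10Tilde id
      (fun hT hL hA => DirichletEnergy.MemH10Tilde.comp hT hL hA)
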